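/- Let $k$ be an algebraically closed field of characteristic $p>0$, let $\mathfrak h$ be a $k$-vector space of finite dimension $n$, and let $\Gamma\subset GL(\mathfrak h)$ be a finite group generated by its set $S$ of pseudo-reflections (elements $s$ with $\operatorname{rank}(\mathrm{Id}-s)=1$ on $\mathfrak h$), such that $2|\Gamma|$ is invertible in $k$. Let $V=\mathfrak h\oplus\mathfrak h^*$ with the symplectic form $\omega((u,f),(x,g))=g(u)-f(x)$, let $\mathbf c:S\to k$ be invariant under conjugation by $\Gamma$, and let $H=H_{1,\mathbf c}$ be the rational Cherednik algebra at $t=1$: the quotient of the skew group algebra $T(V)*\Gamma$ of the tensor algebra by the relations $$xy-yx=\omega(x,y)-\sum_{s\in S}c_s\,\omega_s(x,y)\,s\qquad(x,y\in V),$$ where $\omega_s$ is the form on $V$ that has $\ker(\mathrm{Id}-s)$ in its radical and coincides with $\omega$ on $\operatorname{im}(\mathrm{Id}-s)$. Let $x_1,\dots,x_n$ be a basis of $\mathfrak h$ and $y_1,\dots,y_n$ the dual basis of $\mathfrak h^*$. For each $s\in S$ let $\alpha_s\in\mathfrak h^*$ be a linear form whose kernel is the hyperplane of fixed points of $s$,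 and put $\delta=\prod_{s\in S}\alpha_s\in S(\mathfrak h^*)$. Let $\mathcal D(\mathfrak h)=k[y_1,\dots,y_n,\partial/\partial y_1,\dots,\partial/\partial y_n]$ be the $n$-th Weyl algebra (given by generators and relations), with its natural $\Gamma$-action, for which $\partial/\partial y_i$ transforms like $x_i$; let $\mathcal D(\mathfrak h^{\mathrm{reg}})=\mathcal D(\mathfrak h)[\delta^{-1}]$ be its localisation at the powers of $\delta$, with the induced $\Gamma$-action, and let $\mathcal D(\mathfrak h^{\mathrm{reg}})*\Gamma$ be the skew group algebra. Then there are elements $\tau_1,\dots,\tau_n\in\sum_{s\in S}\alpha_s^{-1}\,k\Gamma\subset\mathcal D(\mathfrak h^{\mathrm{reg}})*\Gamma$ such that the assignment $$\gamma\mapsto\gamma,\qquad y_i\mapsto y_i,\qquad x_i\mapsto\partial/\partial y_i+\tau_i\qquad(\gamma\in\Gamma,\ 1\le i\le n)$$ extends to an injective $k$-algebra homomorphism $\Theta_{\mathbf c}:H\to\mathcal D(\mathfrak h^{\mathrm{reg}})*\Gamma$. Moreover the powers of $\delta$ form a left Ore set in $H$, and $\Theta_{\mathbf c}$ extends to an isomorphism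 $H[\delta^{-1}]\cong\mathcal D(\mathfrak h^{\mathrm{reg}})*\Gamma$. -/

import Mathlib

namespace Cherednik

noncomputable section

/-! ### Skew group algebras -/

section Skew

variable {k A G : Type*} [Field k] [Ring A] [Algebra k A] [Group G]

/-- The algebra `A`, regarded as carrying the action `φ` of `G` by algebra endomorphisms (which are
automatically automorphisms, as `G` is a group). -/
@[nolint unusedArguments]
def WithAction (_φ : G →* (A →ₐ[k] A)) : Type _ := A

variable (φ : G →* (A →ₐ[k] A))

instance : Ring (WithAction φ) := inferInstanceAs (Ring A)

instance : Algebra k (WithAction φ) := inferInstanceAs (Algebra k A)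

instance : MulSemiringAction G (WithAction φ) where
  smul g a := φ g a
  one_smul a := by change φ 1 a = a; rw [map_one]; rfl
  mul_smul g h a := by change φ (g * h) a = φ g (φ h a); rw [map_mul]; rfl
  smul_zero g := map_zero (φ g)
  smul_add g := map_add (φ g)
  smul_one g := map_one (φ g)
  smul_mul g := map_mul (φ g)

instance : SMulCommClass G k (WithAction φ) where
  smul_comm g r a := map_smul (φ g) r a

/-- The skew group algebra `A ∗ G`: the free left `A`-module on `G`, with `(a g)(b h) = a φ_g(b) gh`. -/
abbrev SkewGroupAlgebra : Type _ := SkewMonoidAlgebra (WithAction φ) G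

/-- The inclusion of `A` in `A ∗ G`. -/
def inclAlg : A →ₐ[k] SkewGroupAlgebra φ where
  toFun a := SkewMonoidAlgebra.single (1 : G) (a : WithAction φ)
  map_one' := rfl
  map_mul' a b :=
    map_mul (SkewMonoidAlgebra.singleOneRingHom (k := WithAction φ) (G := G)) a b
  map_zero' := map_zero (SkewMonoidAlgebra.singleOneRingHom (k := WithAction φ) (G := G))
  map_add' a b :=
    map_add (SkewMonoidAlgebra.singleOneRingHom (k := WithAction φ) (G := G)) a b
  commutes' _ := rfl

/-- The inclusion of `G` in `A ∗ G`. -/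
def inclGrp : G →* SkewGroupAlgebra φ := SkewMonoidAlgebra.of (WithAction φ) G

/-- The defining commutation rule `g a = φ_g(a) g` of `A ∗ G`. -/
theorem inclGrp_mul_inclAlg (g : G) (a : A) :
    inclGrp φ g * inclAlg φ a = inclAlg φ (φ g a) * inclGrp φ g := by
  change (SkewMonoidAlgebra.single g (1 : WithAction φ) : SkewGroupAlgebra φ)
      * (SkewMonoidAlgebra.single (1 : G) (show WithAction φ from a) : SkewGroupAlgebra φ)
    = (SkewMonoidAlgebra.single (1 : G) (show WithAction φ from φ g a) : SkewGroupAlgebra φ)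
      * (SkewMonoidAlgebra.single g (1 : WithAction φ) : SkewGroupAlgebra φ)
  rw [SkewMonoidAlgebra.single_mul_single, SkewMonoidAlgebra.single_mul_single]
  rw [one_mul, mul_one, one_mul, one_smul, mul_one]
  rfl

end Skew

/-! ### Symplectic reflection algebras -/

section SRA

variable {k G V : Type*} [Field k] [Group G] [AddCommGroup V] [Module k V]

/-- The action of `G` on the tensor algebra `T(V)` induced by a linear action on `V`. -/
def tensorAction (ρ : Representation k G V) : G →* (TensorAlgebra k V →ₐ[k] TensorAlgebra k V) where
  toFun g := TensorAlgebra.lift k (TensorAlgebra.ι k ∘ₗ ρ g)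
  map_one' := by ext; simp
  map_mul' g h := by ext; simp

/-- The elements `s` of `G` such that `Id - s` has rank `r` on `V`. -/
def elementsOfRank [Fintype G] (ρ : Representation k G V) (r : ℕ) : Finset G :=
  open Classical in
  Finset.univ.filter fun s => Module.finrank k (LinearMap.range (LinearMap.id - ρ s)) = r

/-- The symplectic reflections: `Id - s` has rank 2. -/
abbrev symplecticReflections [Fintype G] (ρ : Representation k G V) : Finset G :=
  elementsOfRank ρ 2

/-- The pseudo-reflections: `Id - s` has rank 1. -/
abbrev pseudoReflections [Fintype G] (ρ : Representation k G V) : Finset G :=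
  elementsOfRank ρ 1

/-- The projection of `V` onto `im (Id - s)` along `ker (Id - s)`, namely
`Id - (1/m) (Id + s + ⋯ + s^(m-1))` where `m` is the order of `s` (invertible in `k`). -/
def reflProj (ρ : Representation k G V) (s : G) : V →ₗ[k] V :=
  LinearMap.id - ((orderOf s : k)⁻¹) • ∑ i ∈ Finset.range (orderOf s), ρ (s ^ i)

theorem reflProj_of_mem_ker (ρ : Representation k G V) (s : G) (hs : (orderOf s : k) ≠ 0) (v : V)
    (hv : v ∈ LinearMap.ker (LinearMap.id - ρ s)) : reflProj ρ s v = 0 := by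
  have h1 : ρ s v = v := by
    have := LinearMap.mem_ker.mp hv
    simp only [LinearMap.sub_apply, LinearMap.id_apply] at this
    exact (sub_eq_zero.mp this).symm
  have h2 : ∀ i : ℕ, ρ (s ^ i) v = v := by
    intro i
    induction i with
    | zero => simp
    | succ i ih => rw [pow_succ, map_mul, Module.End.mul_apply, h1, ih]
  simp only [reflProj, LinearMap.sub_apply, LinearMap.id_apply, LinearMap.smul_apply,
    LinearMap.sum_apply, h2, Finset.sum_const, Finset.card_range]
  rw [← Nat.cast_smul_eq_nsmul k, smul_smul, inv_mul_cancel₀ hs, one_smul, sub_self]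

theorem reflProj_of_mem_range (ρ : Representation k G V) (s : G) (v : V)
    (hv : v ∈ LinearMap.range (LinearMap.id - ρ s)) : reflProj ρ s v = v := by
  obtain ⟨w, rfl⟩ := hv
  have : ∑ i ∈ Finset.range (orderOf s), ρ (s ^ i) (w - ρ s w) = 0 := by
    have h : ∀ i : ℕ, ρ (s ^ i) (w - ρ s w) = ρ (s ^ i) w - ρ (s ^ (i + 1)) w := by
      intro i
      rw [map_sub, pow_succ, map_mul, Module.End.mul_apply]
    simp only [h]
    rw [Finset.sum_range_sub' (fun i => ρ (s ^ i) w), pow_orderOf_eq_one]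
    simp
  simp only [reflProj, LinearMap.sub_apply, LinearMap.id_apply, LinearMap.smul_apply,
    LinearMap.sum_apply, this, smul_zero, sub_zero]

/-- The form `ω_s` that has `ker (Id - s)` in its radical and coincides with `ω` on
`im (Id - s)`. -/
def reflForm (ρ : Representation k G V) (ω : LinearMap.BilinForm k V) (s : G) :
    LinearMap.BilinForm k V :=
  ω.compl₁₂ (reflProj ρ s) (reflProj ρ s)

theorem reflForm_left (ρ : Representation k G V) (ω : LinearMap.BilinForm k V) (s : G)
    (hs : (orderOf s : k) ≠ 0) (x y : V) (hx : x ∈ LinearMap.ker (LinearMap.id - ρ s)) :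
    reflForm ρ ω s x y = 0 := by
  simp [reflForm, reflProj_of_mem_ker ρ s hs x hx]

theorem reflForm_right (ρ : Representation k G V) (ω : LinearMap.BilinForm k V) (s : G)
    (hs : (orderOf s : k) ≠ 0) (x y : V) (hy : y ∈ LinearMap.ker (LinearMap.id - ρ s)) :
    reflForm ρ ω s x y = 0 := by
  simp [reflForm, reflProj_of_mem_ker ρ s hs y hy]

theorem reflForm_range (ρ : Representation k G V) (ω : LinearMap.BilinForm k V) (s : G)
    (x y : V) (hx : x ∈ LinearMap.range (LinearMap.id - ρ s))
    (hy : y ∈ LinearMap.range (LinearMap.id - ρ s)) :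
    reflForm ρ ω s x y = ω x y := by
  simp [reflForm, reflProj_of_mem_range ρ s x hx, reflProj_of_mem_range ρ s y hy]

variable [Fintype G]

/-- The relations `x y - y x = t ω(x,y) - ∑_s c_s ω_s(x,y) s` in `T(V) ∗ G`, the sum being over the
symplectic reflections. -/
inductive SRARel (ρ : Representation k G V) (ω : LinearMap.BilinForm k V) (t : k) (c : G → k) :
    SkewGroupAlgebra (tensorAction ρ) → SkewGroupAlgebra (tensorAction ρ) → Prop
  | comm (x y : V) : SRARel ρ ω t c
      (inclAlg (tensorAction ρ) (TensorAlgebra.ι k x * TensorAlgebra.ι k y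
        - TensorAlgebra.ι k y * TensorAlgebra.ι k x))
      (algebraMap k _ (t * ω x y)
        - ∑ s ∈ symplecticReflections ρ,
            (c s * reflForm ρ ω s x y) • inclGrp (tensorAction ρ) s)

/-- The symplectic reflection algebra `H_{t,c}(V, ω, G)`. Only the values of `c` on symplectic
reflections matter. -/
abbrev SRA (ρ : Representation k G V) (ω : LinearMap.BilinForm k V) (t : k) (c : G → k) : Type _ :=
  RingQuot (SRARel ρ ω t c)

/-- The generators `x ∈ V` of `H_{t,c}`. -/
def sraVec (ρ : Representation k G V) (ω : LinearMap.BilinForm k V) (t : k) (c : G → k) :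
    V →ₗ[k] SRA ρ ω t c :=
  ((RingQuot.mkAlgHom k (SRARel ρ ω t c)).comp (inclAlg (tensorAction ρ))).toLinearMap
    ∘ₗ TensorAlgebra.ι k

/-- The generators `g ∈ G` of `H_{t,c}`. -/
def sraGrp (ρ : Representation k G V) (ω : LinearMap.BilinForm k V) (t : k) (c : G → k) :
    G →* SRA ρ ω t c :=
  (RingQuot.mkAlgHom k (SRARel ρ ω t c) : _ →* SRA ρ ω t c).comp (inclGrp (tensorAction ρ))

theorem sraVec_comm (ρ : Representation k G V) (ω : LinearMap.BilinForm k V) (t : k) (c : G → k)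
    (x y : V) :
    sraVec ρ ω t c x * sraVec ρ ω t c y - sraVec ρ ω t c y * sraVec ρ ω t c x
      = algebraMap k _ (t * ω x y)
        - ∑ s ∈ symplecticReflections ρ, (c s * reflForm ρ ω s x y) • sraGrp ρ ω t c s := by
  have h := RingQuot.mkAlgHom_rel k (SRARel.comm (ρ := ρ) (ω := ω) (t := t) (c := c) x y)
  rw [map_sub, map_sub, map_sub, map_mul, map_mul, map_mul, map_mul, AlgHom.commutes,
    map_sum] at h
  simp only [map_smul] at h
  exact h

end SRA

/-! ### The symmetric algebra and maps out of it -/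

section Sym

variable {k M A : Type*} [Field k] [AddCommGroup M] [Module k M] [Ring A] [Algebra k A]

/-- A linear map with pairwise commuting values in a possibly noncommutative algebra extends to the
symmetric algebra. -/
def symLift (f : M →ₗ[k] A) (hf : ∀ x y, f x * f y = f y * f x) : SymmetricAlgebra k M →ₐ[k] A :=
  RingCon.liftₐ _ (TensorAlgebra.lift k f) (by
    refine RingCon.ringConGen_le.2 ?_
    intro x y h
    cases h with
    | mul_comm x y =>
      change TensorAlgebra.lift k f _ = TensorAlgebra.lift k f _
      simp [hf])

theorem symLift_ι (f : M →ₗ[k] A) (hf : ∀ x y, f x * f y = f y * f x) (x : M) :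
    symLift f hf (SymmetricAlgebra.ι k M x) = f x :=
  TensorAlgebra.lift_ι_apply f x

end Sym

/-! ### A criterion for the powers of an element to form an Ore set -/

section Ore

variable {A : Type*} [Ring A]

/-- Some iterate of `r ↦ a r - r a` kills the given element. -/
def AdNilpotent (a r : A) : Prop := ∃ n : ℕ, (fun x => a * x - x * a)^[n] r = 0

theorem ad_iterate_zero (a : A) (n : ℕ) : (fun x => a * x - x * a)^[n] 0 = 0 := by
  induction n with
  | zero => rfl
  | succ n ih => rw [Function.iterate_succ_apply]; simpa using ih

theorem ad_iterate_mono (a r : A) {m n : ℕ} (hmn : m ≤ n)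
    (h : (fun x => a * x - x * a)^[m] r = 0) : (fun x => a * x - x * a)^[n] r = 0 := by
  obtain ⟨d, rfl⟩ := Nat.exists_eq_add_of_le' hmn
  rw [Function.iterate_add_apply, h, ad_iterate_zero]

theorem ad_iterate_add (a r s : A) (n : ℕ) :
    (fun x => a * x - x * a)^[n] (r + s)
      = (fun x => a * x - x * a)^[n] r + (fun x => a * x - x * a)^[n] s := by
  induction n generalizing r s with
  | zero => rfl
  | succ n ih =>
    rw [Function.iterate_succ_apply, Function.iterate_succ_apply, Function.iterate_succ_apply,
      ← ih]
    congr 1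
    noncomm_ring

theorem AdNilpotent.add {a r s : A} (hr : AdNilpotent a r) (hs : AdNilpotent a s) :
    AdNilpotent a (r + s) := by
  obtain ⟨m, hm⟩ := hr
  obtain ⟨n, hn⟩ := hs
  exact ⟨max m n, by rw [ad_iterate_add, ad_iterate_mono a r (le_max_left m n) hm,
    ad_iterate_mono a s (le_max_right m n) hn, add_zero]⟩

theorem ad_iterate_mul (a : A) (N : ℕ) : ∀ (m n : ℕ), m + n = N → ∀ r s : A,
    (fun x => a * x - x * a)^[m] r = 0 → (fun x => a * x - x * a)^[n] s = 0 →
    (fun x => a * x - x * a)^[N] (r * s) = 0 := by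
  induction N with
  | zero =>
    intro m n hmn r s hr _
    obtain rfl : m = 0 := by omega
    have : r = 0 := hr
    simp [this]
  | succ N ih =>
    intro m n hmn r s hr hs
    rcases m with _ | m
    · have : r = 0 := hr
      rw [this, zero_mul, ad_iterate_zero]
    rcases n with _ | n
    · have : s = 0 := hs
      rw [this, mul_zero, ad_iterate_zero]
    rw [Function.iterate_succ_apply]
    have e : a * (r * s) - r * s * a = (a * r - r * a) * s + r * (a * s - s * a) := by
      noncomm_ring
    simp only [e]
    rw [ad_iterate_add, ih m (n + 1) (by omega) _ s hr hs, ih (m + 1) n (by omega) r _ hr hs,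
      add_zero]

theorem AdNilpotent.mul {a r s : A} (hr : AdNilpotent a r) (hs : AdNilpotent a s) :
    AdNilpotent a (r * s) := by
  obtain ⟨m, hm⟩ := hr
  obtain ⟨n, hn⟩ := hs
  exact ⟨m + n, ad_iterate_mul a _ m n rfl r s hm hn⟩

theorem adNilpotent_of_commute {a r : A} (h : a * r = r * a) : AdNilpotent a r :=
  ⟨1, sub_eq_zero.2 h⟩

theorem AdNilpotent.cancel (a : A) (j N : ℕ) : ∀ r : A,
    (fun x => a * x - x * a)^[N] r = 0 → r * a ^ j = 0 → ∃ n : ℕ, a ^ n * r = 0 := by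
  induction N with
  | zero =>
    intro r hr _
    have : r = 0 := hr
    exact ⟨0, by simp [this]⟩
  | succ N ih =>
    intro r hr hj
    obtain ⟨n, hn⟩ := ih (a * r - r * a) hr (by
      have : (a * r - r * a) * a ^ j = a * (r * a ^ j) - r * a ^ j * a := by
        rw [sub_mul, mul_assoc, mul_assoc r a, mul_assoc r, ← pow_succ, ← pow_succ']
      rw [this, hj]; simp)
    have hc : Commute a (a ^ n * r) := by
      have h1 : a ^ n * (a * r) = a ^ n * (r * a) := by rwa [mul_sub, sub_eq_zero] at hn
      change a * (a ^ n * r) = a ^ n * r * a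
      rw [← mul_assoc, ← pow_succ', pow_succ, mul_assoc, h1, mul_assoc]
    refine ⟨j + n, ?_⟩
    rw [pow_add, mul_assoc, (hc.pow_left j).eq, mul_assoc, hj, mul_zero]

theorem AdNilpotent.ore (a : A) (j N : ℕ) : ∀ r : A,
    (fun x => a * x - x * a)^[N] r = 0 → ∃ (n : ℕ) (r' : A), a ^ n * r = r' * a ^ j := by
  induction N with
  | zero =>
    intro r hr
    have : r = 0 := hr
    exact ⟨0, 0, by simp [this]⟩
  | succ N ih =>
    intro r hr
    obtain ⟨n, r', hn⟩ := ih (a * r - r * a) hr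
    have key : ∀ m : ℕ, ∃ q : A, a ^ (n + m) * r = a ^ n * r * a ^ m + q * a ^ j := by
      intro m
      induction m with
      | zero => exact ⟨0, by simp⟩
      | succ m ihm =>
        obtain ⟨q, hq⟩ := ihm
        have h1 : a ^ (n + 1) * r = a ^ n * r * a + r' * a ^ j := by
          rw [← hn, pow_succ]; noncomm_ring
        refine ⟨r' * a ^ m + a * q, ?_⟩
        calc a ^ (n + (m + 1)) * r = a * (a ^ (n + m) * r) := by
              rw [← mul_assoc, ← pow_succ', add_assoc]
          _ = a ^ (n + 1) * r * a ^ m + a * q * a ^ j := by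
              rw [hq, mul_add, pow_succ']; simp only [mul_assoc]
          _ = a ^ n * r * a ^ (m + 1) + (r' * a ^ m + a * q) * a ^ j := by
              rw [h1, add_mul, add_mul, mul_assoc r', mul_assoc r', ← pow_add, ← pow_add,
                add_comm j m, pow_succ' a m]
              simp only [mul_assoc, add_assoc]
    obtain ⟨q, hq⟩ := key j
    exact ⟨n + j, a ^ n * r + q, by rw [hq, add_mul]⟩

theorem nonempty_oreSet_powers (a : A) (h : ∀ r, AdNilpotent a r) :
    Nonempty (OreLocalization.OreSet (Submonoid.powers a)) := by
  rw [OreLocalization.nonempty_oreSet_iff]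
  constructor
  · rintro r₁ r₂ ⟨_, j, rfl⟩ hr
    obtain ⟨N, hN⟩ := h (r₁ - r₂)
    obtain ⟨n, hn⟩ := AdNilpotent.cancel a j N (r₁ - r₂) hN
      (by rw [sub_mul, sub_eq_zero]; exact hr)
    exact ⟨⟨a ^ n, n, rfl⟩, by rwa [mul_sub, sub_eq_zero] at hn⟩
  · rintro r ⟨_, j, rfl⟩
    obtain ⟨N, hN⟩ := h r
    obtain ⟨n, r', hn⟩ := AdNilpotent.ore a j N r hN
    exact ⟨r', ⟨a ^ n, n, rfl⟩, hn⟩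

end Ore

/-! ### Weyl algebras -/

section Weyl

variable {k V : Type*} [Field k] [AddCommGroup V] [Module k V]

/-- The relations `x y - y x = ω(x,y)`. -/
inductive WeylRel (ω : LinearMap.BilinForm k V) : TensorAlgebra k V → TensorAlgebra k V → Prop
  | comm (x y : V) : WeylRel ω
      (TensorAlgebra.ι k x * TensorAlgebra.ι k y - TensorAlgebra.ι k y * TensorAlgebra.ι k x)
      (algebraMap k _ (ω x y))

/-- The Weyl algebra `T(V) / (x y - y x - ω(x,y))`. -/
abbrev WeylAlgebra (ω : LinearMap.BilinForm k V) : Type _ := RingQuot (WeylRel ω)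

/-- The generators of the Weyl algebra. -/
def weylVec (ω : LinearMap.BilinForm k V) : V →ₗ[k] WeylAlgebra ω :=
  (RingQuot.mkAlgHom k (WeylRel ω)).toLinearMap ∘ₗ TensorAlgebra.ι k

theorem weylVec_comm (ω : LinearMap.BilinForm k V) (x y : V) :
    weylVec ω x * weylVec ω y - weylVec ω y * weylVec ω x = algebraMap k _ (ω x y) := by
  have h := RingQuot.mkAlgHom_rel k (WeylRel.comm (ω := ω) x y)
  rwa [map_sub, map_mul, map_mul, AlgHom.commutes] at h

theorem weyl_induction (ω : LinearMap.BilinForm k V) {P : WeylAlgebra ω → Prop}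
    (hk : ∀ r : k, P (algebraMap k _ r)) (hv : ∀ v, P (weylVec ω v))
    (hmul : ∀ a b, P a → P b → P (a * b)) (hadd : ∀ a b, P a → P b → P (a + b)) (a) : P a := by
  obtain ⟨a, rfl⟩ := RingQuot.mkAlgHom_surjective k (WeylRel ω) a
  induction a using TensorAlgebra.induction with
  | algebraMap r => rw [AlgHom.commutes]; exact hk r
  | ι x => exact hv x
  | mul x y hx hy => rw [map_mul]; exact hmul _ _ hx hy
  | add x y hx hy => rw [map_add]; exact hadd _ _ hx hy

/-- The algebra endomorphism of the Weyl algebra induced by a linear map preserving the form. -/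
def weylMap (ω : LinearMap.BilinForm k V) (f : V →ₗ[k] V) (hf : ∀ x y, ω (f x) (f y) = ω x y) :
    WeylAlgebra ω →ₐ[k] WeylAlgebra ω :=
  RingQuot.liftAlgHom k ⟨TensorAlgebra.lift k (weylVec ω ∘ₗ f), by
    rintro _ _ ⟨x, y⟩
    simp [weylVec_comm, hf]⟩

theorem weylMap_vec (ω : LinearMap.BilinForm k V) (f : V →ₗ[k] V)
    (hf : ∀ x y, ω (f x) (f y) = ω x y) (v : V) :
    weylMap ω f hf (weylVec ω v) = weylVec ω (f v) := by
  simp [weylMap, weylVec]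

theorem weyl_hom_ext (ω : LinearMap.BilinForm k V) {B : Type*} [Ring B] [Algebra k B]
    {F F' : WeylAlgebra ω →ₐ[k] B} (h : ∀ v, F (weylVec ω v) = F' (weylVec ω v)) : F = F' := by
  ext a
  exact h a

end Weyl

/-! ### The rational Cherednik algebra and differential operators -/

section Cherednik

variable {k h G : Type*} [Field k] [AddCommGroup h] [Module k h] [Group G]

/-- The canonical symplectic form on `V = h ⊕ h*`: `ω((u,f),(x,g)) = g(u) - f(x)`. -/
def canonicalForm (k h : Type*) [Field k] [AddCommGroup h] [Module k h] :
    LinearMap.BilinForm k (h × Module.Dual k h) :=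
  LinearMap.mk₂ k (fun a b => b.2 a.1 - a.2 b.1)
    (by intros; simp; ring) (by intros; simp; ring)
    (by intros; simp; ring) (by intros; simp; ring)

theorem canonicalForm_apply (a b : h × Module.Dual k h) :
    canonicalForm k h a b = b.2 a.1 - a.2 b.1 := rfl

/-- The action of `G` on `V = h ⊕ h*`. -/
abbrev doubleRep (ρ : Representation k G h) : Representation k G (h × Module.Dual k h) :=
  ρ.prod ρ.dual

theorem canonicalForm_invariant (ρ : Representation k G h) (g : G) (a b : h × Module.Dual k h) :
    canonicalForm k h (doubleRep ρ g a) (doubleRep ρ g b) = canonicalForm k h a b := by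
  have e : ∀ v : h, ρ g⁻¹ (ρ g v) = v := fun v => by
    rw [← Module.End.mul_apply, ← map_mul]; simp
  simp [canonicalForm_apply, Representation.dual, e]

/-- The algebra `D(h)` of (crystalline) differential operators on `h`, i.e. the `n`-th Weyl algebra,
`n = dim h`. It is generated by the linear functions `f ∈ h*` and the constant vector fields
`∂_u`, `u ∈ h`, with `∂_u f - f ∂_u = f(u)`, the functions commuting with each other, and so
do the vector fields. -/
abbrev DiffOp (k h : Type*) [Field k] [AddCommGroup h] [Module k h] : Type _ :=
  WeylAlgebra (canonicalForm k h)

/-- The derivation `∂_u` along `u ∈ h`. -/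
def partialD : h →ₗ[k] DiffOp k h := weylVec (canonicalForm k h) ∘ₗ LinearMap.inl k _ _

/-- The linear function `f ∈ h*` as a differential operator of order zero. -/
def coordD : Module.Dual k h →ₗ[k] DiffOp k h := weylVec (canonicalForm k h) ∘ₗ LinearMap.inr k _ _

theorem partialD_coordD (u : h) (f : Module.Dual k h) :
    partialD u * coordD f - coordD f * partialD u = algebraMap k _ (f u) := by
  simp [partialD, coordD, weylVec_comm, canonicalForm_apply]

theorem coordD_comm (f g : Module.Dual k h) :
    (coordD f : DiffOp k h) * coordD g = coordD g * coordD f := by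
  rw [← sub_eq_zero]
  simp [coordD, weylVec_comm, canonicalForm_apply]

/-- The inclusion of the polynomial functions `k[h] = S(h*)` in `D(h)`. -/
def polyD : SymmetricAlgebra k (Module.Dual k h) →ₐ[k] DiffOp k h := symLift coordD coordD_comm

/-- The action of `G` on `D(h)`. -/
def diffAction (ρ : Representation k G h) : G →* (DiffOp k h →ₐ[k] DiffOp k h) where
  toFun g := weylMap (canonicalForm k h) (doubleRep ρ g) (canonicalForm_invariant ρ g)
  map_one' := by
    apply weyl_hom_ext
    intro v
    rw [weylMap_vec, map_one]; rfl
  map_mul' g g' := by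
    apply weyl_hom_ext
    intro v
    rw [weylMap_vec, map_mul, AlgHom.mul_apply, weylMap_vec, weylMap_vec]; rfl

theorem adNilpotent_polyD (f : SymmetricAlgebra k (Module.Dual k h)) (a : DiffOp k h) :
    AdNilpotent (polyD f) a := by
  have hpp : ∀ p q : SymmetricAlgebra k (Module.Dual k h),
      (polyD p : DiffOp k h) * polyD q = polyD q * polyD p := fun p q => by
    rw [← map_mul, mul_comm, map_mul]
  have hpart : ∀ (u : h) (p : SymmetricAlgebra k (Module.Dual k h)),
      ∃ q, (polyD p : DiffOp k h) * partialD u - partialD u * polyD p = polyD q := by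
    intro u p
    induction p using SymmetricAlgebra.induction with
    | algebraMap r => exact ⟨0, by rw [AlgHom.commutes, Algebra.commutes]; simp⟩
    | ι x =>
      refine ⟨algebraMap k _ (-(x u)), ?_⟩
      rw [AlgHom.commutes, map_neg, ← partialD_coordD]
      simp [polyD, symLift_ι]
    | mul p q hp hq =>
      obtain ⟨p', hp⟩ := hp
      obtain ⟨q', hq⟩ := hq
      refine ⟨p * q' + p' * q, ?_⟩
      simp only [map_add, map_mul, ← hp, ← hq, mul_sub, sub_mul, mul_assoc]
      abel
    | add p q hp hq =>
      obtain ⟨p', hp⟩ := hp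
      obtain ⟨q', hq⟩ := hq
      refine ⟨p' + q', ?_⟩
      simp only [map_add, ← hp, ← hq]
      noncomm_ring
  induction a using weyl_induction with
  | hk r => exact adNilpotent_of_commute (Algebra.commutes r _).symm
  | hv v =>
    have : weylVec (canonicalForm k h) v
        = partialD v.1 + polyD (SymmetricAlgebra.ι k _ v.2) := by
      rw [polyD, symLift_ι, partialD, coordD]
      simp [← map_add]
    rw [this]
    refine AdNilpotent.add ?_ (adNilpotent_of_commute (hpp _ _))
    obtain ⟨q, hq⟩ := hpart v.1 f
    refine ⟨2, ?_⟩
    change polyD f * (polyD f * partialD v.1 - partialD v.1 * polyD f)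
      - (polyD f * partialD v.1 - partialD v.1 * polyD f) * polyD f = 0
    rw [hq, hpp, sub_self]
  | hmul a b ha hb => exact ha.mul hb
  | hadd a b ha hb => exact ha.add hb

/-- The powers of a polynomial function form an Ore set in `D(h)`. -/
instance orePolyD (f : SymmetricAlgebra k (Module.Dual k h)) :
    OreLocalization.OreSet (Submonoid.powers (polyD f : DiffOp k h)) :=
  (nonempty_oreSet_powers _ (adNilpotent_polyD f)).some

variable [Fintype G]

theorem finrank_range_prodMap {V W : Type*} [AddCommGroup V] [Module k V] [FiniteDimensional k V]
    [AddCommGroup W] [Module k W] [FiniteDimensional k W] (f : V →ₗ[k] V) (g : W →ₗ[k] W) :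
    Module.finrank k (LinearMap.range (f.prodMap g))
      = Module.finrank k (LinearMap.range f) + Module.finrank k (LinearMap.range g) := by
  let e : (LinearMap.range f).prod (LinearMap.range g)
      ≃ₗ[k] LinearMap.range f × LinearMap.range g :=
    { toFun := fun x => (⟨x.1.1, x.2.1⟩, ⟨x.1.2, x.2.2⟩)
      invFun := fun x => ⟨(x.1.1, x.2.1), x.1.2, x.2.2⟩
      map_add' := fun _ _ => rfl
      map_smul' := fun _ _ => rfl
      left_inv := fun _ => rfl
      right_inv := fun _ => rfl }
  rw [LinearMap.range_prodMap, e.finrank_eq, Module.finrank_prod]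

/-- The symplectic reflections on `h ⊕ h*` are the pseudo-reflections on `h`. -/
theorem symplecticReflections_doubleRep [FiniteDimensional k h] (ρ : Representation k G h) :
    symplecticReflections (doubleRep ρ) = pseudoReflections ρ := by
  have hinv : ∀ (x : G) (v : h), ρ x (ρ x⁻¹ v) = v := fun x v => by
    rw [← Module.End.mul_apply, ← map_mul]; simp
  have hinv' : ∀ (x : G) (v : h), ρ x⁻¹ (ρ x v) = v := fun x v => by
    rw [← Module.End.mul_apply, ← map_mul]; simp
  have hrank : ∀ s : G, Module.finrank k (LinearMap.range (LinearMap.id - doubleRep ρ s))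
      = 2 * Module.finrank k (LinearMap.range (LinearMap.id - ρ s)) := by
    intro s
    have e1 : LinearMap.id - doubleRep ρ s
        = (LinearMap.id - ρ s).prodMap (LinearMap.id - ρ.dual s) := by
      ext <;> simp [Representation.prod]
    have e2 : LinearMap.id - ρ.dual s = (LinearMap.id - ρ s⁻¹).dualMap := by
      ext f v
      simp only [LinearMap.sub_apply, LinearMap.id_apply, Representation.dual_apply,
        LinearMap.dualMap_apply, map_sub]
      rfl
    have e3 : LinearMap.range (LinearMap.id - ρ s⁻¹) = LinearMap.range (LinearMap.id - ρ s) := by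
      apply le_antisymm
      · rintro _ ⟨v, rfl⟩
        exact ⟨-(ρ s⁻¹ v), by simp [hinv, sub_eq_add_neg, add_comm]⟩
      · rintro _ ⟨v, rfl⟩
        exact ⟨-(ρ s v), by simp [hinv', sub_eq_add_neg, add_comm]⟩
    rw [e1, finrank_range_prodMap, e2]
    exact (congrArg (_ + ·) ((LinearMap.finrank_range_dualMap_eq_finrank_range _).trans
      (by rw [e3]))).trans (two_mul _).symm
  ext s
  simp only [elementsOfRank, Finset.mem_filter, Finset.mem_univ, true_and, hrank]
  omega

/-- The polynomial `δ = ∏_s α_s`, the product over all pseudo-reflections. -/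
def delta (ρ : Representation k G h) (α : G → Module.Dual k h) :
    SymmetricAlgebra k (Module.Dual k h) :=
  ∏ s ∈ pseudoReflections ρ, SymmetricAlgebra.ι k _ (α s)

/-- The algebra `D(h^reg) = D(h)[δ⁻¹]` of differential operators on the complement `h^reg` of the
reflecting hyperplanes. -/
def DiffReg (ρ : Representation k G h) (α : G → Module.Dual k h) : Type _ :=
  OreLocalization (Submonoid.powers (polyD (delta ρ α) : DiffOp k h)) (DiffOp k h)

instance (ρ : Representation k G h) (α : G → Module.Dual k h) : Ring (DiffReg ρ α) :=
  inferInstanceAs (Ring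
    (OreLocalization (Submonoid.powers (polyD (delta ρ α) : DiffOp k h)) (DiffOp k h)))

instance (ρ : Representation k G h) (α : G → Module.Dual k h) : Algebra k (DiffReg ρ α) :=
  inferInstanceAs (Algebra k
    (OreLocalization (Submonoid.powers (polyD (delta ρ α) : DiffOp k h)) (DiffOp k h)))

/-- The localisation map `D(h) → D(h^reg)`. -/
def toReg (ρ : Representation k G h) (α : G → Module.Dual k h) : DiffOp k h →ₐ[k] DiffReg ρ α where
  __ := OreLocalization.numeratorRingHom
  commutes' _ := rfl

theorem diffAction_delta (ρ : Representation k G h) (α : G → Module.Dual k h)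
    (hα : ∀ s ∈ pseudoReflections ρ,
      LinearMap.ker (α s) = LinearMap.ker (LinearMap.id - ρ s)) (g : G) :
    ∃ r : k, r ≠ 0 ∧ diffAction ρ g (polyD (delta ρ α)) = r • polyD (delta ρ α) := by
  have hι : ∀ f : Module.Dual k h, diffAction ρ g (polyD (SymmetricAlgebra.ι k _ f))
      = polyD (SymmetricAlgebra.ι k _ (ρ.dual g f)) := by
    intro f
    rw [polyD, symLift_ι, symLift_ι]
    change weylMap _ _ (canonicalForm_invariant ρ g) (weylVec _ _) = weylVec _ _
    rw [weylMap_vec]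
    simp
  have hinv : ∀ (x : G) (v : h), ρ x (ρ x⁻¹ v) = v := fun x v => by
    rw [← Module.End.mul_apply, ← map_mul]; simp
  have hinv' : ∀ (x : G) (v : h), ρ x⁻¹ (ρ x v) = v := fun x v => by
    rw [← Module.End.mul_apply, ← map_mul]; simp
  have hconj : ∀ s, s ∈ pseudoReflections ρ → ∀ x : G, x * s * x⁻¹ ∈ pseudoReflections ρ := by
    intro s hs x
    simp only [elementsOfRank, Finset.mem_filter, Finset.mem_univ, true_and] at hs ⊢
    rw [← hs]
    let e : h ≃ₗ[k] h := LinearEquiv.ofLinearMap (ρ x) (ρ x⁻¹)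
      (LinearMap.ext (hinv x)) (LinearMap.ext (hinv' x))
    have h1 : LinearMap.range (LinearMap.id - ρ (x * s * x⁻¹))
        = (LinearMap.range (LinearMap.id - ρ s)).map (e : h →ₗ[k] h) := by
      have : LinearMap.id - ρ (x * s * x⁻¹)
          = (e : h →ₗ[k] h) ∘ₗ (LinearMap.id - ρ s) ∘ₗ (e.symm : h →ₗ[k] h) := by
        ext v
        simp [e, hinv]
      rw [this, LinearMap.range_comp, LinearMap.range_comp, LinearEquiv.range, Submodule.map_top]
    rw [h1, LinearEquiv.finrank_map_eq]
  have hscal : ∀ f f' : Module.Dual k h, LinearMap.ker f = LinearMap.ker f' →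
      ∃ r : k, r ≠ 0 ∧ f = r • f' := by
    intro f f' hff
    by_cases h0 : f = 0
    · refine ⟨1, one_ne_zero, ?_⟩
      rw [h0, LinearMap.ker_zero] at hff
      rw [h0, LinearMap.ker_eq_top.1 hff.symm, smul_zero]
    · obtain ⟨v, hv⟩ : ∃ v, f v ≠ 0 := by
        by_contra! hcon
        exact h0 (LinearMap.ext hcon)
      have hv' : f' v ≠ 0 := fun h' => hv (by
        have : v ∈ LinearMap.ker f' := h'
        rwa [← hff] at this)
      refine ⟨f v / f' v, div_ne_zero hv hv', ?_⟩
      ext w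
      have hw : w - (f' w / f' v) • v ∈ LinearMap.ker f := by
        rw [hff, LinearMap.mem_ker]
        simp [hv']
      have hw' := LinearMap.mem_ker.1 hw
      simp only [map_sub, map_smul, smul_eq_mul, sub_eq_zero] at hw'
      rw [hw', LinearMap.smul_apply, smul_eq_mul]
      field_simp
  have hroot : ∀ s : G, ∃ r : k, r ≠ 0 ∧ (s ∈ pseudoReflections ρ →
      ρ.dual g (α s) = r • α (g * s * g⁻¹)) := by
    intro s
    by_cases hs : s ∈ pseudoReflections ρ
    · obtain ⟨r, hr, hr'⟩ := hscal (ρ.dual g (α s)) (α (g * s * g⁻¹)) (by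
        rw [hα _ (hconj s hs g)]
        have h2 : ∀ v, α s v = 0 ↔ v - ρ s v = 0 := fun v => by
          have := SetLike.ext_iff.1 (hα s hs) v
          simpa using this
        ext v
        simp only [LinearMap.mem_ker, Representation.dual_apply, LinearMap.sub_apply,
          LinearMap.id_apply, Module.Dual.transpose_apply, LinearMap.comp_apply]
        rw [h2, sub_eq_zero, sub_eq_zero]
        constructor
        · intro h3
          rw [map_mul, map_mul, Module.End.mul_apply, Module.End.mul_apply, ← h3, hinv]
        · intro h3
          conv_lhs => rw [h3]
          rw [map_mul, map_mul, Module.End.mul_apply, Module.End.mul_apply, hinv'])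
      exact ⟨r, hr, fun _ => hr'⟩
    · exact ⟨1, one_ne_zero, fun h' => absurd h' hs⟩
  choose r hr hr' using hroot
  refine ⟨∏ s ∈ pseudoReflections ρ, r s, Finset.prod_ne_zero_iff.2 fun s _ => hr s, ?_⟩
  let F : SymmetricAlgebra k (Module.Dual k h) →ₐ[k] SymmetricAlgebra k (Module.Dual k h) :=
    SymmetricAlgebra.lift (SymmetricAlgebra.ι k _ ∘ₗ ρ.dual g)
  have hF : ∀ q, diffAction ρ g (polyD q) = polyD (F q) := by
    intro q
    induction q using SymmetricAlgebra.induction with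
    | algebraMap r => simp
    | ι x => rw [hι]; simp [F]
    | mul p q hp hq => simp [hp, hq]
    | add p q hp hq => simp [hp, hq]
  rw [hF, ← map_smul]
  congr 1
  rw [delta, map_prod, Algebra.smul_def, map_prod]
  have h4 : ∀ s ∈ pseudoReflections ρ, F (SymmetricAlgebra.ι k _ (α s))
      = algebraMap k _ (r s) * SymmetricAlgebra.ι k _ (α (g * s * g⁻¹)) := by
    intro s hs
    simp only [F, SymmetricAlgebra.lift_ι_apply, LinearMap.comp_apply]
    rw [hr' s hs, map_smul, Algebra.smul_def]
  rw [Finset.prod_congr rfl h4, Finset.prod_mul_distrib]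
  congr 1
  refine Finset.prod_bij' (fun s _ => g * s * g⁻¹) (fun s _ => g⁻¹ * s * g)
    (fun s hs => hconj s hs g) (fun s hs => by simpa using hconj s hs g⁻¹) ?_ ?_ ?_
  · intro s _; group
  · intro s _; group
  · intro s _; rfl

theorem isUnit_toReg_delta (ρ : Representation k G h) (α : G → Module.Dual k h) :
    IsUnit (toReg ρ α (polyD (delta ρ α))) :=
  OreLocalization.numerator_isUnit
    (⟨polyD (delta ρ α), Submonoid.mem_powers _⟩ :
      Submonoid.powers (polyD (delta ρ α) : DiffOp k h))

theorem isUnit_toReg_diffAction (ρ : Representation k G h) (α : G → Module.Dual k h)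
    (hα : ∀ s ∈ pseudoReflections ρ,
      LinearMap.ker (α s) = LinearMap.ker (LinearMap.id - ρ s)) (g : G)
    (s : Submonoid.powers (polyD (delta ρ α) : DiffOp k h)) :
    IsUnit (toReg ρ α (diffAction ρ g s)) := by
  obtain ⟨_, n, rfl⟩ := s
  obtain ⟨r, hr, hr'⟩ := diffAction_delta ρ α hα g
  simp only [map_pow, hr', map_smul]
  refine IsUnit.pow _ ?_
  rw [Algebra.smul_def]
  exact ((IsUnit.mk0 r hr).map _).mul (isUnit_toReg_delta ρ α)

/-- The automorphism of `D(h^reg)` induced by `g ∈ G`. -/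
def regMap (ρ : Representation k G h) (α : G → Module.Dual k h)
    (hα : ∀ s ∈ pseudoReflections ρ,
      LinearMap.ker (α s) = LinearMap.ker (LinearMap.id - ρ s)) (g : G) :
    DiffReg ρ α →ₐ[k] DiffReg ρ α where
  __ := OreLocalization.universalHom
    (((toReg ρ α).comp (diffAction ρ g) : DiffOp k h →ₐ[k] DiffReg ρ α) :
      DiffOp k h →+* DiffReg ρ α)
    (IsUnit.liftRight
      ((((toReg ρ α).comp (diffAction ρ g) : DiffOp k h →ₐ[k] DiffReg ρ α) :
        DiffOp k h →* DiffReg ρ α).comp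
          (Submonoid.powers (polyD (delta ρ α) : DiffOp k h)).subtype)
      (isUnit_toReg_diffAction ρ α hα g))
    (fun _ => rfl)
  commutes' r := by
    refine (OreLocalization.universalHom_commutes _ _ _).trans ?_
    exact AlgHom.commutes ((toReg ρ α).comp (diffAction ρ g)) r

theorem regMap_toReg (ρ : Representation k G h) (α : G → Module.Dual k h)
    (hα : ∀ s ∈ pseudoReflections ρ,
      LinearMap.ker (α s) = LinearMap.ker (LinearMap.id - ρ s)) (g : G) (a : DiffOp k h) :
    regMap ρ α hα g (toReg ρ α a) = toReg ρ α (diffAction ρ g a) :=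
  OreLocalization.universalHom_commutes _ _ _

theorem reg_hom_ext (ρ : Representation k G h) (α : G → Module.Dual k h)
    {B : Type*} [Ring B] [Algebra k B] {F F' : DiffReg ρ α →ₐ[k] B}
    (hF : ∀ a, F (toReg ρ α a) = F' (toReg ρ α a)) : F = F' := by
  have hu : ∀ s : Submonoid.powers (polyD (delta ρ α) : DiffOp k h),
      IsUnit (F (toReg ρ α s)) := fun s => by
    obtain ⟨_, n, rfl⟩ := s
    simp only [map_pow]
    exact ((isUnit_toReg_delta ρ α).map F).pow n
  let f : DiffOp k h →+* B := (F.comp (toReg ρ α) : DiffOp k h →ₐ[k] B)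
  let fS := IsUnit.liftRight
    ((f : DiffOp k h →* B).comp (Submonoid.powers (polyD (delta ρ α) : DiffOp k h)).subtype) hu
  have h1 := OreLocalization.universalHom_unique f fS (fun _ => rfl) (F : DiffReg ρ α →+* B)
    (fun _ => rfl)
  have h2 := OreLocalization.universalHom_unique f fS (fun _ => rfl) (F' : DiffReg ρ α →+* B)
    (fun a => (hF a).symm)
  ext a
  exact congrArg (fun φ : DiffReg ρ α →+* B => φ a) (h1.trans h2.symm)

/-- The action of `G` on `D(h^reg)`, extending the one on `D(h)`. -/
def regAction (ρ : Representation k G h) (α : G → Module.Dual k h)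
    (hα : ∀ s ∈ pseudoReflections ρ,
      LinearMap.ker (α s) = LinearMap.ker (LinearMap.id - ρ s)) :
    G →* (DiffReg ρ α →ₐ[k] DiffReg ρ α) where
  toFun g := regMap ρ α hα g
  map_one' := by
    apply reg_hom_ext
    intro a
    rw [regMap_toReg, map_one]; rfl
  map_mul' g g' := by
    apply reg_hom_ext
    intro a
    change _ = regMap ρ α hα g (regMap ρ α hα g' (toReg ρ α a))
    rw [regMap_toReg, map_mul, AlgHom.mul_apply, regMap_toReg, regMap_toReg]

/-- The `k`-subspace `∑_s α_s⁻¹ kG` of `D(h^reg) ∗ G`, the sum being over the pseudo-reflections. -/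
def rootSpan (ρ : Representation k G h) (α : G → Module.Dual k h)
    (hα : ∀ s ∈ pseudoReflections ρ,
      LinearMap.ker (α s) = LinearMap.ker (LinearMap.id - ρ s)) :
    Submodule k (SkewGroupAlgebra (regAction ρ α hα)) :=
  Submodule.span k {q | ∃ s ∈ pseudoReflections ρ, ∃ (g : G) (a : DiffReg ρ α),
    a * toReg ρ α (coordD (α s)) = 1 ∧ toReg ρ α (coordD (α s)) * a = 1 ∧
      q = inclAlg (regAction ρ α hα) a * inclGrp (regAction ρ α hα) g}

/-- The rational Cherednik algebra `H_{1,c}(h ⊕ h*, ω, G)`. -/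
abbrev RCA (ρ : Representation k G h) (c : G → k) : Type _ :=
  SRA (doubleRep ρ) (canonicalForm k h) 1 c

/-- The generator of the Cherednik algebra given by a vector of `h`. -/
def rcaX (ρ : Representation k G h) (c : G → k) : h →ₗ[k] RCA ρ c :=
  sraVec (doubleRep ρ) (canonicalForm k h) 1 c ∘ₗ LinearMap.inl k _ _

/-- The generator of the Cherednik algebra given by a linear function on `h`. -/
def rcaY (ρ : Representation k G h) (c : G → k) : Module.Dual k h →ₗ[k] RCA ρ c :=
  sraVec (doubleRep ρ) (canonicalForm k h) 1 c ∘ₗ LinearMap.inr k _ _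

/-- The generator of the Cherednik algebra given by an element of the group. -/
def rcaGrp (ρ : Representation k G h) (c : G → k) : G →* RCA ρ c :=
  sraGrp (doubleRep ρ) (canonicalForm k h) 1 c

theorem rcaY_comm (ρ : Representation k G h) (c : G → k) (f g : Module.Dual k h) :
    rcaY ρ c f * rcaY ρ c g = rcaY ρ c g * rcaY ρ c f := by
  have hfst : ∀ (s : G) (f : Module.Dual k h), (reflProj (doubleRep ρ) s (0, f)).1 = 0 := by
    intro s f
    have hpow : ∀ i : ℕ, (doubleRep ρ (s ^ i) (0, f)).1 = 0 := fun i => by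
      simp only [Representation.prod_apply_apply, map_zero]
    simp only [reflProj, LinearMap.sub_apply, LinearMap.id_apply, LinearMap.smul_apply,
      LinearMap.sum_apply, Prod.fst_sub, Prod.smul_fst, Prod.fst_sum, hpow, Finset.sum_const_zero,
      smul_zero, sub_zero]
  rw [← sub_eq_zero]
  refine (sraVec_comm _ _ _ _ _ _).trans ?_
  simp [reflForm, canonicalForm_apply, hfst]

/-- The inclusion of `k[h] = S(h*)` in the Cherednik algebra. -/
def polyH (ρ : Representation k G h) (c : G → k) :
    SymmetricAlgebra k (Module.Dual k h) →ₐ[k] RCA ρ c :=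
  symLift (rcaY ρ c) (rcaY_comm ρ c)

end Cherednik

end

end Cherednik

/-! Each pseudo-reflection satisfies `s⁻¹ v = v - α_s(v) a_s` for a vector `a_s`, and since the
order of `s` is invertible, `α_s(a_s) ≠ 0`. In these terms `ω_s(u,f) = α_s(u) f(a_s) / α_s(a_s)` for
`u ∈ h`, `f ∈ h*`. The map sends `u` to the Dunkl element `D_u = ∂_u + T_u`, where `T_u = ∑_s (c_s /
α_s(a_s)) α_s(u) α_s⁻¹ s`. Moving a linear form `f` past `α_s⁻¹ s` costs exactly `f(a_s) s`, which
gives the relation between `h` and `h*`; conjugation invariance of `c` gives equivariance.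

The substantial relation is `D_u D_v = D_v D_u` (`dunkl_comm`). Put `z = [D_u, D_v]`. By the Jacobi
identity `z` commutes with every linear form, because `[D_u, [D_v, f]]` is symmetric in `u` and `v`
(`dunkl_commutator_coordD`). The terms of `z` containing derivatives cancel, so `z = [T_u, T_v]` has
functions `z_g` as coefficients (`dunkl_commutator_eq`). Commuting with `f` means `z_g (g f - f) =
0`; as `G` acts faithfully, `z_g = 0` for `g ≠ 1`. For `g = 1` only pairs `s, s⁻¹` contribute, and
their roots are proportional, so `z_1 = 0` too (`root_mul_root_inv`).

Injectivity and localisation come from comparing leading terms. The commutation relations show that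
the elements `p x^β g` span `H` (`rcaOrder_surjective`). The elements `p ∂^β g` are independent in
`D(h^reg) ∗ G` (`skewOrder_injective`); in characteristic `p` the action of `D(h)` on polynomials is
not faithful, so independence is seen on a larger module where `∂_i` acts as `ξ_i + ∂_i`. Filter
`D(h^reg) ∗ G` by order in the `∂_i` (`orderLT`). The image of `x^β g` is `∂^β g` plus terms of
smaller order (`dunklHom_monH_sub_mem`). So no nonzero normal-ordered sum is sent to zero, and by
induction on the order every element lands in the image after multiplication by a power of `δ`. The
Ore condition and the isomorphism are then formal (`exists_oreLocalization_equiv`). -/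

namespace Cherednik

noncomputable section

set_option linter.unusedSectionVars false

/-! ### Localisation recognised from an injective map into a ring of left fractions -/

section Ore

/-- If `Θ : A → B` is injective, `Θ a` is invertible and every element of `B` is a left fraction
`Θ(a)⁻ⁿ Θ(r)`, then the powers of `a` are a left Ore set and `Θ` extends to `A[a⁻¹] ≃ B`. -/
theorem exists_oreLocalization_equiv {k A B : Type*} [Field k] [Ring A] [Algebra k A] [Ring B]
    [Algebra k B] (Θ : A →ₐ[k] B) (hΘ : Function.Injective Θ) (a : A) (ha : IsUnit (Θ a))
    (hfrac : ∀ w : B, ∃ (n : ℕ) (r : A), Θ a ^ n * w = Θ r) :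
    ∃ (_ : OreLocalization.OreSet (Submonoid.powers a))
      (Φ : OreLocalization (Submonoid.powers a) A ≃ₐ[k] B),
      ∀ x : A, Φ (OreLocalization.numeratorHom x) = Θ x := by
  have hore : Nonempty (OreLocalization.OreSet (Submonoid.powers a)) := by
    rw [OreLocalization.nonempty_oreSet_iff]
    constructor
    · rintro r₁ r₂ ⟨_, j, rfl⟩ hr
      refine ⟨1, ?_⟩
      have h1 : Θ r₁ * Θ a ^ j = Θ r₂ * Θ a ^ j := by
        rw [← map_pow, ← map_mul, ← map_mul]; exact congrArg Θ hr
      rw [hΘ ((ha.pow j).mul_right_cancel h1)]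
    · rintro r ⟨_, j, rfl⟩
      -- The right fraction `Θ(r) Θ(a)⁻ʲ` lives in `B`, where it can be rewritten as a left
      -- fraction; injectivity pulls the resulting identity back to `A`.
      obtain ⟨n, r', hn⟩ := hfrac (Θ r * ((ha.pow j).unit⁻¹ : Bˣ))
      refine ⟨r', ⟨a ^ n, n, rfl⟩, hΘ ?_⟩
      change Θ (a ^ n * r) = Θ (r' * a ^ j)
      rw [map_mul, map_mul, ← hn, map_pow, map_pow, mul_assoc, mul_assoc,
        IsUnit.val_inv_mul, mul_one]
  obtain ⟨inst⟩ := hore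
  refine ⟨inst, ?_⟩
  have hu : ∀ s : Submonoid.powers a, IsUnit (Θ s) := by
    rintro ⟨_, j, rfl⟩
    simpa using ha.pow j
  let F : OreLocalization (Submonoid.powers a) A →+* B :=
    OreLocalization.universalHom (Θ : A →+* B)
      (IsUnit.liftRight ((Θ : A →* B).comp (Submonoid.powers a).subtype) hu) (fun _ => rfl)
  have hF : ∀ x : A, F (OreLocalization.numeratorHom x) = Θ x := fun x =>
    OreLocalization.universalHom_commutes _ _ _
  have hdiv : ∀ (r : A) (s : Submonoid.powers a),
      OreLocalization.numeratorHom (s : A) * (OreLocalization.oreDiv r s)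
        = (OreLocalization.numeratorHom r : OreLocalization (Submonoid.powers a) A) := by
    intro r s
    rw [OreLocalization.numeratorHom_apply, OreLocalization.numeratorHom_apply,
      OreLocalization.mul_cancel]
  have hdiv' : ∀ (r : A) (s : Submonoid.powers a), Θ s * F (OreLocalization.oreDiv r s) = Θ r := by
    intro r s
    rw [← hF, ← hF, ← map_mul, hdiv]
  let F' : OreLocalization (Submonoid.powers a) A →ₐ[k] B :=
    { F with commutes' := fun r => (hF (algebraMap k A r)).trans (Θ.commutes r) }
  refine ⟨AlgEquiv.ofBijective F' ⟨?_, ?_⟩, hF⟩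
  · rw [injective_iff_map_eq_zero]
    intro x
    induction x using OreLocalization.ind with
    | _ r s =>
      intro hx
      have h1 : Θ r = 0 := by
        rw [← hdiv' r s]
        change _ * F' _ = 0
        rw [hx, mul_zero]
      have h2 : r = 0 := hΘ (by rw [h1, map_zero])
      rw [h2, OreLocalization.zero_oreDiv]
  · intro w
    obtain ⟨n, r, hn⟩ := hfrac w
    refine ⟨OreLocalization.oreDiv r ⟨a ^ n, n, rfl⟩, ?_⟩
    refine (hu ⟨a ^ n, n, rfl⟩).mul_left_cancel ?_
    refine (hdiv' _ _).trans ?_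
    rw [← hn]
    simp

end Ore

/-! ### Directional derivatives on a symmetric algebra -/

section Derivation

variable {k M : Type*} [Field k] [AddCommGroup M] [Module k M]

/-- The homomorphism `p ↦ p + ε d_φ(p)` to the dual numbers. -/
def symJet (φ : M →ₗ[k] k) : SymmetricAlgebra k M →ₐ[k]
    TrivSqZeroExt (SymmetricAlgebra k M) (SymmetricAlgebra k M) :=
  SymmetricAlgebra.lift
    ((TrivSqZeroExt.inlAlgHom k (SymmetricAlgebra k M) (SymmetricAlgebra k M)).toLinearMap
        ∘ₗ SymmetricAlgebra.ι k M
      + (TrivSqZeroExt.inrHom (SymmetricAlgebra k M) (SymmetricAlgebra k M)).restrictScalars k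
        ∘ₗ Algebra.linearMap k (SymmetricAlgebra k M) ∘ₗ φ)

theorem symJet_fst (φ : M →ₗ[k] k) (p : SymmetricAlgebra k M) : (symJet φ p).fst = p := by
  have : (TrivSqZeroExt.fstHom k (SymmetricAlgebra k M) (SymmetricAlgebra k M)).comp (symJet φ)
      = AlgHom.id k _ := by
    apply SymmetricAlgebra.algHom_ext
    ext x
    simp [symJet]
  exact DFunLike.congr_fun this p

/-- The derivation of the symmetric algebra extending a linear form. -/
def symDeriv (φ : M →ₗ[k] k) : SymmetricAlgebra k M →ₗ[k] SymmetricAlgebra k M :=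
  (TrivSqZeroExt.sndHom (SymmetricAlgebra k M) (SymmetricAlgebra k M)).restrictScalars k
    ∘ₗ (symJet φ).toLinearMap

theorem symDeriv_ι (φ : M →ₗ[k] k) (x : M) :
    symDeriv φ (SymmetricAlgebra.ι k M x) = algebraMap k _ (φ x) := by
  simp [symDeriv, symJet, Algebra.algebraMap_eq_smul_one]

theorem symDeriv_mul (φ : M →ₗ[k] k) (p q : SymmetricAlgebra k M) :
    symDeriv φ (p * q) = p * symDeriv φ q + symDeriv φ p * q := by
  simp [symDeriv, symJet_fst, mul_comm]

theorem symDeriv_algebraMap (φ : M →ₗ[k] k) (r : k) : symDeriv φ (algebraMap k _ r) = 0 := by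
  simp [symDeriv, TrivSqZeroExt.algebraMap_eq_inl']

theorem symDeriv_one (φ : M →ₗ[k] k) : symDeriv φ 1 = 0 := by
  rw [← map_one (algebraMap k _), symDeriv_algebraMap]

/-- The two sides agree on generators, where both vanish, and the mixed terms of the Leibniz rule
are symmetric. This is what makes the operators `symbolPartial` commute. -/
theorem symDeriv_comm (φ ψ : M →ₗ[k] k) (p : SymmetricAlgebra k M) :
    symDeriv φ (symDeriv ψ p) = symDeriv ψ (symDeriv φ p) := by
  induction p using SymmetricAlgebra.induction with
  | algebraMap r => simp [symDeriv_algebraMap]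
  | ι x => simp [symDeriv_ι, symDeriv_algebraMap]
  | mul p q hp hq => simp only [symDeriv_mul, map_add, hp, hq]; ring
  | add p q hp hq => simp only [map_add, hp, hq]

theorem sym_hom_ext {B : Type*} [Ring B] [Algebra k B] {F F' : SymmetricAlgebra k M →ₐ[k] B}
    (h : ∀ x, F (SymmetricAlgebra.ι k M x) = F' (SymmetricAlgebra.ι k M x)) : F = F' := by
  apply AlgHom.ext
  intro p
  induction p using SymmetricAlgebra.induction with
  | algebraMap r => simp
  | ι x => exact h x
  | mul p q hp hq => rw [map_mul, map_mul, hp, hq]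
  | add p q hp hq => rw [map_add, map_add, hp, hq]

end Derivation

/-! ### Sums with polynomial coefficients on the left -/

section NormalOrder

variable {k S B ι : Type*} [Field k] [CommRing S] [Algebra k S] [Ring B] [Algebra k B]

/-- The linear map sending a finitely supported family `(p_i)` to `∑ p_i m_i`. -/
def normalOrder (P : S →ₐ[k] B) (m : ι → B) : (ι →₀ S) →ₗ[k] B :=
  Finsupp.lsum k fun i => LinearMap.mulRight k (m i) ∘ₗ P.toLinearMap

theorem normalOrder_single (P : S →ₐ[k] B) (m : ι → B) (i : ι) (p : S) :
    normalOrder P m (Finsupp.single i p) = P p * m i := by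
  simp [normalOrder]

theorem normalOrder_smul (P : S →ₐ[k] B) (m : ι → B) (q : S) (z : ι →₀ S) :
    normalOrder P m (q • z) = P q * normalOrder P m z := by
  induction z using Finsupp.induction_linear with
  | zero => simp
  | add z z' hz hz' => rw [smul_add, map_add, hz, hz', map_add, mul_add]
  | single i p => rw [Finsupp.smul_single, normalOrder_single, normalOrder_single, smul_eq_mul,
      map_mul, mul_assoc]

end NormalOrder

/-! ### Monomials in a symmetric algebra -/

section Monomial

variable {k h : Type*} [Field k] [AddCommGroup h] [Module k h] {n : ℕ}

/-- The monomial `∏ x_i^(β i)` in the symmetric algebra. -/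
def symMonomial (b : Module.Basis (Fin n) k h) (β : Fin n →₀ ℕ) : SymmetricAlgebra k h :=
  ∏ i, SymmetricAlgebra.ι k h (b i) ^ β i

theorem symMonomial_zero (b : Module.Basis (Fin n) k h) : symMonomial b 0 = 1 := by
  simp [symMonomial]

theorem symMonomial_add_single (b : Module.Basis (Fin n) k h) (β : Fin n →₀ ℕ) (i : Fin n) :
    symMonomial b (β + Finsupp.single i 1)
      = symMonomial b β * SymmetricAlgebra.ι k h (b i) := by
  classical
  simp only [symMonomial, Finsupp.add_apply, pow_add, Finset.prod_mul_distrib]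
  congr 1
  rw [Finset.prod_eq_single i]
  · simp
  · intro j _ hj
    rw [Finsupp.single_eq_of_ne hj, pow_zero]
  · simp

theorem exponent_induction {P : (Fin n →₀ ℕ) → Prop} (h0 : P 0)
    (hadd : ∀ β i, P β → P (β + Finsupp.single i 1)) (β : Fin n →₀ ℕ) : P β := by
  -- The translated form is the one that composes under sums of exponents.
  suffices h : ∀ γ, P γ → P (γ + β) by simpa using h 0 h0
  induction β using Finsupp.induction_linear with
  | zero => intro γ hγ; simpa using hγ
  | add β β' hβ hβ' => intro γ hγ; rw [← add_assoc]; exact hβ' _ (hβ _ hγ)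
  | single i m =>
    induction m with
    | zero => intro γ hγ; simpa using hγ
    | succ m ih => intro γ hγ; rw [Finsupp.single_add, ← add_assoc]; exact hadd _ _ (ih _ hγ)

theorem ι_mul_mem_span_symMonomial (b : Module.Basis (Fin n) k h) (u : h)
    {x : SymmetricAlgebra k h} (hx : x ∈ Submodule.span k (Set.range (symMonomial b))) :
    SymmetricAlgebra.ι k h u * x ∈ Submodule.span k (Set.range (symMonomial b)) := by
  induction hx using Submodule.span_induction with
  | mem x hx =>
    obtain ⟨β, rfl⟩ := hx
    rw [← b.sum_repr u, map_sum, Finset.sum_mul]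
    refine Submodule.sum_mem _ fun i _ => ?_
    rw [map_smul, smul_mul_assoc, mul_comm, ← symMonomial_add_single]
    exact Submodule.smul_mem _ _ (Submodule.subset_span ⟨_, rfl⟩)
  | zero => simp
  | add x y _ _ hx hy => rw [mul_add]; exact Submodule.add_mem _ hx hy
  | smul r x _ hx => rw [mul_smul_comm]; exact Submodule.smul_mem _ _ hx

theorem span_symMonomial (b : Module.Basis (Fin n) k h) :
    Submodule.span k (Set.range (symMonomial b)) = ⊤ := by
  rw [eq_top_iff]
  rintro a -
  -- Stability under left multiplication by `a`, unlike membership of `a`, passes to products;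
  -- membership is recovered by applying it to `1`.
  suffices H : ∀ x ∈ Submodule.span k (Set.range (symMonomial b)),
      a * x ∈ Submodule.span k (Set.range (symMonomial b)) by
    have := H 1 (Submodule.subset_span ⟨0, symMonomial_zero b⟩)
    rwa [mul_one] at this
  induction a using SymmetricAlgebra.induction with
  | algebraMap r => intro x hx; rw [← Algebra.smul_def]; exact Submodule.smul_mem _ _ hx
  | ι u => exact fun x hx => ι_mul_mem_span_symMonomial b u hx
  | mul p q hp hq => intro x hx; rw [mul_assoc]; exact hp _ (hq _ hx)
  | add p q hp hq => intro x hx; rw [add_mul]; exact Submodule.add_mem _ (hp _ hx) (hq _ hx)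

end Monomial

/-! ### Normal-ordered basis of the Weyl algebra in any characteristic -/

section WeylBasis

variable {k h : Type*} [Field k] [AddCommGroup h] [Module k h] {n : ℕ}

theorem partialD_comm (u v : h) :
    (partialD u : DiffOp k h) * partialD v = partialD v * partialD u := by
  rw [← sub_eq_zero]
  simp [partialD, weylVec_comm, canonicalForm_apply]

theorem weylVec_eq (v : h × Module.Dual k h) :
    weylVec (canonicalForm k h) v = partialD v.1 + coordD v.2 := by
  simp [partialD, coordD, ← map_add]

theorem polyD_ι (f : Module.Dual k h) :
    (polyD (SymmetricAlgebra.ι k _ f) : DiffOp k h) = coordD f := symLift_ι _ _ _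

/-- The constant-coefficient differential operators `S(h) → D(h)`. -/
def constD : SymmetricAlgebra k h →ₐ[k] DiffOp k h := symLift partialD partialD_comm

theorem constD_ι (u : h) : (constD (SymmetricAlgebra.ι k _ u) : DiffOp k h) = partialD u :=
  symLift_ι _ _ _

/-- The derivation of `S(h*)` along `u ∈ h`. -/
abbrev dirDeriv (u : h) : SymmetricAlgebra k (Module.Dual k h) →ₗ[k]
    SymmetricAlgebra k (Module.Dual k h) := symDeriv (Module.Dual.eval k h u)

theorem partialD_polyD (u : h) (p : SymmetricAlgebra k (Module.Dual k h)) :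
    partialD u * polyD p = polyD p * partialD u + polyD (dirDeriv u p) := by
  induction p using SymmetricAlgebra.induction with
  | algebraMap r => simp [symDeriv_algebraMap, Algebra.commutes]
  | ι x =>
    rw [symDeriv_ι, AlgHom.commutes, polyD_ι, Module.Dual.eval_apply, ← partialD_coordD]
    abel
  | mul p q hp hq =>
    rw [symDeriv_mul, map_mul, map_add, map_mul, map_mul, ← mul_assoc, hp, add_mul, mul_assoc, hq,
      mul_add, mul_assoc]
    abel
  | add p q hp hq => rw [map_add, map_add, map_add, mul_add, hp, hq, add_mul]; abel

/-- The operator `ξ_i + ∂_i` on `S(h*)[ξ_1, …, ξ_n]`. -/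
def symbolPartial (b : Module.Basis (Fin n) k h) (i : Fin n) :
    Module.End k ((Fin n →₀ ℕ) →₀ SymmetricAlgebra k (Module.Dual k h)) :=
  Finsupp.lmapDomain _ k (fun β => β + Finsupp.single i 1)
    + Finsupp.mapRange.linearMap (dirDeriv (b i))

theorem symbolPartial_single (b : Module.Basis (Fin n) k h) (i : Fin n) (β : Fin n →₀ ℕ)
    (p : SymmetricAlgebra k (Module.Dual k h)) :
    symbolPartial b i (Finsupp.single β p)
      = Finsupp.single (β + Finsupp.single i 1) p + Finsupp.single β (dirDeriv (b i) p) := by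
  simp [symbolPartial, Finsupp.mapDomain_single]

theorem symbolPartial_comm (b : Module.Basis (Fin n) k h) (i j : Fin n) :
    Commute (symbolPartial b i) (symbolPartial b j) := by
  apply LinearMap.ext
  intro z
  induction z using Finsupp.induction_linear with
  | zero => simp
  | add z z' hz hz' => rw [map_add, map_add, hz, hz']
  | single β p =>
    simp only [Module.End.mul_apply, symbolPartial_single, map_add]
    rw [symDeriv_comm, add_right_comm β]
    abel

theorem commute_constr {B : Type*} [Ring B] [Algebra k B] (b : Module.Basis (Fin n) k h)
    (x : Fin n → B) (hx : ∀ i j, Commute (x i) (x j)) (u v : h) :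
    Commute (b.constr k x u) (b.constr k x v) := by
  rw [b.constr_apply_fintype (S := k), b.constr_apply_fintype (S := k)]
  exact Commute.sum_left _ _ _ fun i _ => Commute.sum_right _ _ _ fun j _ =>
    ((hx i j).smul_left _).smul_right _

/-- The action of `h ⊕ h*` on `S(h*)[ξ_1, …, ξ_n]`. -/
def symbolVec (b : Module.Basis (Fin n) k h) : h × Module.Dual k h →ₗ[k]
    Module.End k ((Fin n →₀ ℕ) →₀ SymmetricAlgebra k (Module.Dual k h)) :=
  (b.constr k (symbolPartial b)).coprod
    ((Algebra.lsmul k k ((Fin n →₀ ℕ) →₀ SymmetricAlgebra k (Module.Dual k h))).toLinearMap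
      ∘ₗ SymmetricAlgebra.ι k _)

theorem dirDeriv_eq_sum (b : Module.Basis (Fin n) k h) (u : h)
    (q : SymmetricAlgebra k (Module.Dual k h)) :
    dirDeriv u q = ∑ i, b.repr u i • dirDeriv (b i) q := by
  induction q using SymmetricAlgebra.induction with
  | algebraMap r => simp [symDeriv_algebraMap]
  | ι f =>
    have hf : f u = ∑ i, b.repr u i * f (b i) := by
      conv_lhs => rw [← b.sum_repr u, map_sum]
      simp only [map_smul, smul_eq_mul]
    simp [symDeriv_ι, hf, Algebra.smul_def]
  | mul p q hp hq =>
    simp only [symDeriv_mul] at hp hq ⊢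
    rw [hp, hq]
    simp only [smul_add, Finset.sum_add_distrib, Finset.mul_sum, Finset.sum_mul, mul_smul_comm,
      smul_mul_assoc]
  | add p q hp hq =>
    simp only [map_add, smul_add, Finset.sum_add_distrib]
    rw [hp, hq]

theorem symbolPartial_smul (b : Module.Basis (Fin n) k h) (u : h)
    (q : SymmetricAlgebra k (Module.Dual k h))
    (z : (Fin n →₀ ℕ) →₀ SymmetricAlgebra k (Module.Dual k h)) :
    b.constr k (symbolPartial b) u (q • z)
      = q • b.constr k (symbolPartial b) u z + dirDeriv u q • z := by
  have key : ∀ i, symbolPartial b i (q • z)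
      = q • symbolPartial b i z + dirDeriv (b i) q • z := by
    intro i
    induction z using Finsupp.induction_linear with
    | zero => simp
    | add z z' hz hz' => rw [smul_add, map_add, hz, hz', map_add, smul_add, smul_add]; abel
    | single β p =>
      simp only [Finsupp.smul_single, symbolPartial_single, smul_eq_mul, symDeriv_mul, smul_add,
        Finsupp.single_add]
      abel
  rw [dirDeriv_eq_sum b, b.constr_apply_fintype (S := k)]
  simp only [LinearMap.sum_apply, LinearMap.smul_apply, Module.Basis.equivFun_apply, key, smul_add,
    Finset.sum_add_distrib, Finset.smul_sum, Finset.sum_smul, smul_assoc]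
  congr 1
  exact Finset.sum_congr rfl fun i _ => smul_comm _ _ _

/-- The action of `D(h)` on `S(h*)[ξ_1, …, ξ_n]`. -/
def symbolRep (b : Module.Basis (Fin n) k h) : DiffOp k h →ₐ[k]
    Module.End k ((Fin n →₀ ℕ) →₀ SymmetricAlgebra k (Module.Dual k h)) :=
  RingQuot.liftAlgHom k ⟨TensorAlgebra.lift k (symbolVec b), by
    rintro _ _ ⟨x, y⟩
    -- The `h`-parts commute with each other and the `h*`-parts are multiplications; the mixed
    -- brackets are read off from the Leibniz rule `symbolPartial_smul`.
    have h1 := fun z => LinearMap.congr_fun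
      (commute_constr b (symbolPartial b) (symbolPartial_comm b) x.1 y.1).eq z
    simp only [Module.End.mul_apply] at h1
    apply LinearMap.ext
    intro z
    simp only [map_sub, map_mul, TensorAlgebra.lift_ι_apply, AlgHom.commutes, symbolVec,
      LinearMap.coprod_apply, LinearMap.sub_apply, Module.End.mul_apply, LinearMap.add_apply,
      LinearMap.comp_apply, AlgHom.toLinearMap_apply, Algebra.lsmul_coe, map_add,
      symbolPartial_smul, symDeriv_ι, canonicalForm_apply, Module.Dual.eval_apply,
      Module.algebraMap_end_apply, algebraMap_smul, h1]
    rw [smul_comm (SymmetricAlgebra.ι k _ y.2)]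
    abel⟩

theorem symbolRep_vec (b : Module.Basis (Fin n) k h) (v : h × Module.Dual k h) :
    symbolRep b (weylVec _ v) = symbolVec b v := by
  simp [symbolRep, weylVec]

theorem symbolRep_polyD (b : Module.Basis (Fin n) k h)
    (p : SymmetricAlgebra k (Module.Dual k h)) :
    symbolRep b (polyD p) = Algebra.lsmul k k _ p := by
  have : (symbolRep b).comp polyD
      = Algebra.lsmul k k ((Fin n →₀ ℕ) →₀ SymmetricAlgebra k (Module.Dual k h)) := by
    refine sym_hom_ext
      (B := Module.End k ((Fin n →₀ ℕ) →₀ SymmetricAlgebra k (Module.Dual k h))) fun f => ?_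
    change symbolRep b (polyD (SymmetricAlgebra.ι k _ f)) = _
    rw [polyD_ι]
    refine (symbolRep_vec b _).trans ?_
    simp [symbolVec]
  exact DFunLike.congr_fun this p

theorem symbolRep_partialD (b : Module.Basis (Fin n) k h) (i : Fin n) :
    symbolRep b (partialD (b i)) = symbolPartial b i := by
  refine (symbolRep_vec b _).trans ?_
  simp [symbolVec]

/-- On a vector with constant coefficient the derivative part of `ξ_i + ∂_i` vanishes, so each
factor only raises an exponent. Distinct monomials thus stay distinct, even for exponents `≥ p`,
where `∂_i^p` kills all polynomials. -/
theorem symbolRep_monomial (b : Module.Basis (Fin n) k h) (β : Fin n →₀ ℕ) :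
    symbolRep b (constD (symMonomial b β)) (Finsupp.single 0 1) = Finsupp.single β 1 := by
  induction β using exponent_induction with
  | h0 => simp [symMonomial_zero]
  | hadd β i ih =>
    rw [symMonomial_add_single, mul_comm, map_mul, map_mul, Module.End.mul_apply, ih, constD_ι,
      symbolRep_partialD, symbolPartial_single, symDeriv_one, Finsupp.single_zero, add_zero]

/-- The normal ordering map `∑ p_β ξ^β ↦ ∑ p_β ∂^β`. -/
abbrev weylOrder (b : Module.Basis (Fin n) k h) :
    ((Fin n →₀ ℕ) →₀ SymmetricAlgebra k (Module.Dual k h)) →ₗ[k] DiffOp k h :=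
  normalOrder polyD fun β => constD (symMonomial b β)

/-- Letting an operator act on the vector `1` reads off its normal-ordered coefficients, which is a
left inverse. -/
theorem weylOrder_injective (b : Module.Basis (Fin n) k h) :
    Function.Injective (weylOrder b) := by
  apply Function.LeftInverse.injective (g := fun a => symbolRep b a (Finsupp.single 0 1))
  intro z
  change symbolRep b _ _ = z
  induction z using Finsupp.induction_linear with
  | zero => simp
  | add z z' hz hz' => rw [map_add, map_add, LinearMap.add_apply, hz, hz']
  | single β p =>
    rw [normalOrder_single, map_mul, Module.End.mul_apply, symbolRep_monomial, symbolRep_polyD]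
    simp

/-- Used to prove spanning: it suffices to multiply by generators on the left. -/
theorem weyl_leftIdeal_eq_top (N : Submodule k (DiffOp k h))
    (h1 : (1 : DiffOp k h) ∈ N) (hf : ∀ f, ∀ x ∈ N, coordD f * x ∈ N)
    (hu : ∀ u, ∀ x ∈ N, partialD u * x ∈ N) : N = ⊤ := by
  rw [eq_top_iff]
  rintro a -
  suffices H : ∀ x ∈ N, a * x ∈ N by simpa using H 1 h1
  induction a using weyl_induction with
  | hk r => intro x hx; rw [← Algebra.smul_def]; exact N.smul_mem _ hx
  | hv v => intro x hx; rw [weylVec_eq, add_mul]; exact N.add_mem (hu _ _ hx) (hf _ _ hx)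
  | hmul a b ha hb => intro x hx; rw [mul_assoc]; exact ha _ (hb _ hx)
  | hadd a b ha hb => intro x hx; rw [add_mul]; exact N.add_mem (ha _ hx) (hb _ hx)

theorem constD_mem_range_weylOrder (b : Module.Basis (Fin n) k h) (q : SymmetricAlgebra k h) :
    (constD q : DiffOp k h) ∈ LinearMap.range (weylOrder b) := by
  have hq : q ∈ Submodule.span k (Set.range (symMonomial b)) := by rw [span_symMonomial]; trivial
  induction hq using Submodule.span_induction with
  | mem x hx =>
    obtain ⟨β, rfl⟩ := hx
    exact ⟨Finsupp.single β 1, by simp [normalOrder_single]⟩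
  | zero => simp
  | add x y _ _ hx hy => rw [map_add]; exact Submodule.add_mem _ hx hy
  | smul r x _ hx => rw [map_smul]; exact Submodule.smul_mem _ _ hx

theorem polyD_mul_mem_range_weylOrder (b : Module.Basis (Fin n) k h)
    (p : SymmetricAlgebra k (Module.Dual k h)) {x : DiffOp k h}
    (hx : x ∈ LinearMap.range (weylOrder b)) : polyD p * x ∈ LinearMap.range (weylOrder b) := by
  obtain ⟨z, rfl⟩ := hx
  exact ⟨p • z, normalOrder_smul _ _ _ _⟩

/-- The normal-ordered elements form a left ideal: moving `∂_u` to the right of a polynomial only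
adds the derivative of that polynomial. -/
theorem weylOrder_surjective (b : Module.Basis (Fin n) k h) :
    Function.Surjective (weylOrder b) := by
  rw [← LinearMap.range_eq_top]
  refine weyl_leftIdeal_eq_top _ ?_ ?_ ?_
  · rw [← map_one constD]; exact constD_mem_range_weylOrder b 1
  · intro f x hx
    rw [← polyD_ι]
    exact polyD_mul_mem_range_weylOrder b _ hx
  · rintro u _ ⟨z, rfl⟩
    induction z using Finsupp.induction_linear with
    | zero => simp
    | add z z' hz hz' => rw [map_add, mul_add]; exact Submodule.add_mem _ hz hz'
    | single β p =>
      rw [normalOrder_single, ← mul_assoc, partialD_polyD, add_mul, mul_assoc, ← constD_ι,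
        ← map_mul]
      exact Submodule.add_mem _
        (polyD_mul_mem_range_weylOrder b _ (constD_mem_range_weylOrder b _))
        (polyD_mul_mem_range_weylOrder b _ (constD_mem_range_weylOrder b _))

end WeylBasis

/-! ### Injectivity of the localisation map and the ring of functions on `h^reg` -/

section Regular

variable {k h G : Type*} [Field k] [AddCommGroup h] [Module k h] [FiniteDimensional k h]
  [Group G] [Fintype G] {n : ℕ}

theorem root_ne_zero (ρ : Representation k G h) (α : G → Module.Dual k h)
    (hα : ∀ s ∈ pseudoReflections ρ,
      LinearMap.ker (α s) = LinearMap.ker (LinearMap.id - ρ s))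
    {s : G} (hs : s ∈ pseudoReflections ρ) : α s ≠ 0 := by
  intro h0
  have h1 := hα s hs
  rw [h0, LinearMap.ker_zero] at h1
  simp only [elementsOfRank, Finset.mem_filter, Finset.mem_univ, true_and] at hs
  rw [LinearMap.ker_eq_top.1 h1.symm, LinearMap.range_zero, finrank_bot] at hs
  exact zero_ne_one hs

/-- Some derivation sends the generator to a nonzero constant. -/
theorem sym_ι_ne_zero {M : Type*} [AddCommGroup M] [Module k M] {f : M} (hf : f ≠ 0) :
    SymmetricAlgebra.ι k M f ≠ 0 := by
  obtain ⟨φ, hφ⟩ : ∃ φ : Module.Dual k M, φ f ≠ 0 := by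
    by_contra! hcon
    exact hf ((Module.forall_dual_apply_eq_zero_iff k f).1 hcon)
  intro h0
  have h1 := symDeriv_ι φ f
  rw [h0, map_zero, eq_comm, SymmetricAlgebra.algebraMap_eq_zero_iff] at h1
  exact hφ h1

theorem delta_ne_zero (ρ : Representation k G h) (α : G → Module.Dual k h)
    (hα : ∀ s ∈ pseudoReflections ρ,
      LinearMap.ker (α s) = LinearMap.ker (LinearMap.id - ρ s)) : delta ρ α ≠ 0 :=
  Finset.prod_ne_zero_iff.2 fun _ hs => sym_ι_ne_zero (root_ne_zero ρ α hα hs)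

/-- Left multiplication by `p` acts coefficientwise on the normal-ordered form, and `S(h*)` is a
domain. -/
theorem polyD_mul_eq_zero {p : SymmetricAlgebra k (Module.Dual k h)} (hp : p ≠ 0)
    {a : DiffOp k h} (ha : polyD p * a = 0) : a = 0 := by
  obtain ⟨z, rfl⟩ := weylOrder_surjective (Module.finBasis k h) a
  rw [← normalOrder_smul] at ha
  have h1 : p • z = 0 := weylOrder_injective (Module.finBasis k h) (ha.trans (map_zero _).symm)
  have h2 : z = 0 := by
    ext β
    have := DFunLike.congr_fun h1 β
    simpa [hp] using this
  rw [h2, map_zero]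

theorem polyD_injective : Function.Injective (polyD : _ →ₐ[k] DiffOp k h) := by
  rw [injective_iff_map_eq_zero]
  intro p hp
  by_contra h0
  -- A nonzero `p` with zero image would annihilate `1`, whereas `D(h)` is nontrivial because it
  -- acts on a nonzero module.
  have h1 : (1 : DiffOp k h) = 0 := polyD_mul_eq_zero h0 (by rw [hp, zero_mul])
  have h2 := congrArg (symbolRep (Module.finBasis k h)) h1
  rw [map_one, map_zero] at h2
  have h3 := LinearMap.congr_fun h2 (Finsupp.single 0 1)
  simp at h3

theorem toReg_injective (ρ : Representation k G h) (α : G → Module.Dual k h)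
    (hα : ∀ s ∈ pseudoReflections ρ,
      LinearMap.ker (α s) = LinearMap.ker (LinearMap.id - ρ s)) :
    Function.Injective (toReg ρ α) := by
  refine OreLocalization.numeratorHom_inj ?_
  rintro _ ⟨j, rfl⟩
  rw [mem_nonZeroDivisorsLeft_iff]
  intro x hx
  change polyD (delta ρ α) ^ j * x = 0 at hx
  rw [← map_pow] at hx
  exact polyD_mul_eq_zero (pow_ne_zero j (delta_ne_zero ρ α hα)) hx

/-- The polynomial functions inside `D(h^reg)`. -/
abbrev polyR (ρ : Representation k G h) (α : G → Module.Dual k h) :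
    SymmetricAlgebra k (Module.Dual k h) →ₐ[k] DiffReg ρ α := (toReg ρ α).comp polyD

theorem polyR_injective (ρ : Representation k G h) (α : G → Module.Dual k h)
    (hα : ∀ s ∈ pseudoReflections ρ,
      LinearMap.ker (α s) = LinearMap.ker (LinearMap.id - ρ s)) :
    Function.Injective (polyR ρ α) := (toReg_injective ρ α hα).comp polyD_injective

/-- The action of `G` on the polynomial functions. -/
def symAct (ρ : Representation k G h) (g : G) : SymmetricAlgebra k (Module.Dual k h) →ₐ[k]
    SymmetricAlgebra k (Module.Dual k h) :=
  SymmetricAlgebra.lift (SymmetricAlgebra.ι k _ ∘ₗ ρ.dual g)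

theorem symAct_ι (ρ : Representation k G h) (g : G) (f : Module.Dual k h) :
    symAct ρ g (SymmetricAlgebra.ι k _ f) = SymmetricAlgebra.ι k _ (ρ.dual g f) := by
  simp [symAct]

theorem diffAction_coordD (ρ : Representation k G h) (g : G) (f : Module.Dual k h) :
    diffAction ρ g (coordD f) = coordD (ρ.dual g f) := by
  change weylMap _ _ (canonicalForm_invariant ρ g) (weylVec _ _) = weylVec _ _
  rw [weylMap_vec]
  simp

theorem diffAction_partialD (ρ : Representation k G h) (g : G) (u : h) :
    diffAction ρ g (partialD u) = partialD (ρ g u) := by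
  change weylMap _ _ (canonicalForm_invariant ρ g) (weylVec _ _) = weylVec _ _
  rw [weylMap_vec]
  simp

theorem diffAction_polyD (ρ : Representation k G h) (g : G)
    (p : SymmetricAlgebra k (Module.Dual k h)) :
    diffAction ρ g (polyD p) = polyD (symAct ρ g p) := by
  have : (diffAction ρ g).comp polyD = polyD.comp (symAct ρ g) := by
    refine sym_hom_ext fun f => ?_
    simp only [AlgHom.comp_apply, symAct_ι, polyD_ι, diffAction_coordD]
  exact DFunLike.congr_fun this p

theorem isUnit_polyR_delta (ρ : Representation k G h) (α : G → Module.Dual k h) :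
    IsUnit (polyR ρ α (delta ρ α)) := isUnit_toReg_delta ρ α

theorem exists_delta_pow_mul (ρ : Representation k G h) (α : G → Module.Dual k h)
    (a : DiffReg ρ α) : ∃ (j : ℕ) (r : DiffOp k h),
      polyR ρ α (delta ρ α) ^ j * a = toReg ρ α r := by
  induction a using OreLocalization.ind with
  | _ r s =>
    obtain ⟨_, j, rfl⟩ := s
    refine ⟨j, r, ?_⟩
    rw [AlgHom.comp_apply, ← map_pow (toReg ρ α)]
    exact OreLocalization.mul_cancel (r := r) (t := 1)
      (s := (⟨polyD (delta ρ α) ^ j, j, rfl⟩ : Submonoid.powers (polyD (delta ρ α) : DiffOp k h)))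

/-- The functions on `h^reg`, inside `D(h^reg)`. -/
def regFun (ρ : Representation k G h) (α : G → Module.Dual k h) :
    Subalgebra k (DiffReg ρ α) where
  carrier := {a | ∃ (N : ℕ) (p : SymmetricAlgebra k (Module.Dual k h)),
    polyR ρ α (delta ρ α) ^ N * a = polyR ρ α p}
  mul_mem' := by
    rintro a a' ⟨N, p, hp⟩ ⟨M, q, hq⟩
    refine ⟨M + N, p * q, ?_⟩
    rw [map_mul, ← hq, pow_add, mul_assoc, ← mul_assoc _ a, hp, ← map_pow, ← mul_assoc,
      ← map_mul, mul_comm, map_mul, mul_assoc]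
  add_mem' := by
    rintro a a' ⟨N, p, hp⟩ ⟨M, q, hq⟩
    refine ⟨M + N, delta ρ α ^ M * p + delta ρ α ^ N * q, ?_⟩
    rw [mul_add, pow_add, mul_assoc, hp, ← pow_add, add_comm M, pow_add, mul_assoc, hq]
    simp only [map_add, map_mul, map_pow]
  algebraMap_mem' r := ⟨0, algebraMap k _ r, by simp⟩

theorem regFun_of_delta_pow_mul (ρ : Representation k G h) (α : G → Module.Dual k h)
    {a : DiffReg ρ α} (N : ℕ) (ha : polyR ρ α (delta ρ α) ^ N * a ∈ regFun ρ α) :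
    a ∈ regFun ρ α := by
  obtain ⟨M, p, hp⟩ := ha
  exact ⟨M + N, p, by rw [pow_add, mul_assoc, hp]⟩

theorem polyR_mem_regFun (ρ : Representation k G h) (α : G → Module.Dual k h)
    (p : SymmetricAlgebra k (Module.Dual k h)) : polyR ρ α p ∈ regFun ρ α :=
  ⟨0, p, by rw [pow_zero, one_mul]⟩

theorem regFun_commute (ρ : Representation k G h) (α : G → Module.Dual k h)
    {a : DiffReg ρ α} (ha : a ∈ regFun ρ α) (q : SymmetricAlgebra k (Module.Dual k h)) :
    a * polyR ρ α q = polyR ρ α q * a := by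
  obtain ⟨N, p, hp⟩ := ha
  refine ((isUnit_polyR_delta ρ α).pow N).mul_left_cancel ?_
  rw [← mul_assoc, hp, ← map_mul, mul_comm, map_mul, ← hp, ← mul_assoc, ← mul_assoc, ← map_pow,
    ← map_mul, mul_comm, map_mul]

theorem regFun_mul_polyR_eq_zero (ρ : Representation k G h) (α : G → Module.Dual k h)
    (hα : ∀ s ∈ pseudoReflections ρ,
      LinearMap.ker (α s) = LinearMap.ker (LinearMap.id - ρ s))
    {a : DiffReg ρ α} (ha : a ∈ regFun ρ α) {q : SymmetricAlgebra k (Module.Dual k h)}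
    (hq : q ≠ 0) (h0 : a * polyR ρ α q = 0) : a = 0 := by
  obtain ⟨N, p, hp⟩ := ha
  have h1 : polyR ρ α (p * q) = 0 := by rw [map_mul, ← hp, mul_assoc, h0, mul_zero]
  have h2 : p * q = 0 := polyR_injective ρ α hα (h1.trans (map_zero _).symm)
  have h3 : p = 0 := (mul_eq_zero.1 h2).resolve_right hq
  refine ((isUnit_polyR_delta ρ α).pow N).mul_left_cancel ?_
  rw [hp, h3, map_zero, mul_zero]

/-- The group multiplies `δ` by nonzero scalars, so a denominator `δ^N` remains one. -/
theorem regMap_mem_regFun (ρ : Representation k G h) (α : G → Module.Dual k h)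
    (hα : ∀ s ∈ pseudoReflections ρ,
      LinearMap.ker (α s) = LinearMap.ker (LinearMap.id - ρ s)) (g : G)
    {a : DiffReg ρ α} (ha : a ∈ regFun ρ α) : regAction ρ α hα g a ∈ regFun ρ α := by
  obtain ⟨N, p, hp⟩ := ha
  obtain ⟨r, hr, hr'⟩ := diffAction_delta ρ α hα g
  have h1 : ∀ q, regAction ρ α hα g (polyR ρ α q) = toReg ρ α (diffAction ρ g (polyD q)) :=
    fun q => regMap_toReg ρ α hα g _
  have h2 := congrArg (regAction ρ α hα g) hp
  rw [map_mul, map_pow, h1, h1, hr', map_smul, diffAction_polyD, smul_pow] at h2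
  refine regFun_of_delta_pow_mul ρ α N ?_
  have h3 : polyR ρ α (delta ρ α) ^ N * regAction ρ α hα g a
      = (r ^ N)⁻¹ • polyR ρ α (symAct ρ g p) := by
    rw [eq_inv_smul_iff₀ (pow_ne_zero N hr), ← smul_mul_assoc]
    exact h2
  rw [h3]
  exact (regFun ρ α).smul_mem (polyR_mem_regFun ρ α _) _

/-- The commutator with `∂_u` is the derivative of a fraction. With `δ^N a = p`, the quotient rule
takes the form `δ^N [∂_u, a] = ∂_u(p) - ∂_u(δ^N) a`. -/
theorem partialD_regFun (ρ : Representation k G h) (α : G → Module.Dual k h) (u : h)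
    {a : DiffReg ρ α} (ha : a ∈ regFun ρ α) :
    ∃ a' ∈ regFun ρ α, toReg ρ α (partialD u) * a = a * toReg ρ α (partialD u) + a' := by
  have key : ∀ q, toReg ρ α (partialD u) * polyR ρ α q
      = polyR ρ α q * toReg ρ α (partialD u) + polyR ρ α (dirDeriv u q) := fun q => by
    simp only [AlgHom.comp_apply, ← map_mul, ← map_add, partialD_polyD]
  obtain ⟨N, p, hp⟩ := id ha
  refine ⟨toReg ρ α (partialD u) * a - a * toReg ρ α (partialD u),
    regFun_of_delta_pow_mul ρ α N ?_, by abel⟩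
  have h1 : polyR ρ α (delta ρ α) ^ N * (toReg ρ α (partialD u) * a - a * toReg ρ α (partialD u))
      = polyR ρ α (dirDeriv u p) - polyR ρ α (dirDeriv u (delta ρ α ^ N)) * a := by
    have h2 := key (delta ρ α ^ N)
    rw [map_pow (polyR ρ α), ← sub_eq_iff_eq_add] at h2
    rw [mul_sub, ← mul_assoc, ← mul_assoc, hp, ← h2, sub_mul, mul_assoc _ _ a, hp, key]
    abel
  rw [h1]
  exact sub_mem (polyR_mem_regFun ρ α _) (mul_mem (polyR_mem_regFun ρ α _) ha)

theorem isUnit_root (ρ : Representation k G h) (α : G → Module.Dual k h) {s : G}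
    (hs : s ∈ pseudoReflections ρ) : IsUnit (toReg ρ α (coordD (α s))) := by
  classical
  have h1 := isUnit_polyR_delta ρ α
  rw [delta, ← Finset.mul_prod_erase _ _ hs, map_mul] at h1
  have h2 := ((Commute.all _ _).map (polyR ρ α)).isUnit_mul_iff.1 h1
  rw [← polyD_ι]
  exact h2.1

/-- The inverse of the linear form `α_s` in `D(h^reg)`. -/
def rootInv (ρ : Representation k G h) (α : G → Module.Dual k h) (s : G) : DiffReg ρ α :=
  Ring.inverse (toReg ρ α (coordD (α s)))

theorem rootInv_mul (ρ : Representation k G h) (α : G → Module.Dual k h) {s : G}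
    (hs : s ∈ pseudoReflections ρ) : rootInv ρ α s * toReg ρ α (coordD (α s)) = 1 :=
  Ring.inverse_mul_cancel _ (isUnit_root ρ α hs)

theorem mul_rootInv (ρ : Representation k G h) (α : G → Module.Dual k h) {s : G}
    (hs : s ∈ pseudoReflections ρ) : toReg ρ α (coordD (α s)) * rootInv ρ α s = 1 :=
  Ring.mul_inverse_cancel _ (isUnit_root ρ α hs)

theorem rootInv_mem_regFun (ρ : Representation k G h) (α : G → Module.Dual k h) {s : G}
    (hs : s ∈ pseudoReflections ρ) : rootInv ρ α s ∈ regFun ρ α := by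
  classical
  refine ⟨1, ∏ t ∈ (pseudoReflections ρ).erase s, SymmetricAlgebra.ι k _ (α t), ?_⟩
  rw [pow_one, delta, ← Finset.mul_prod_erase _ _ hs, mul_comm, map_mul, mul_assoc,
    AlgHom.comp_apply _ _ (SymmetricAlgebra.ι k _ (α s)), polyD_ι, mul_rootInv ρ α hs, mul_one]

end Regular

/-! ### The order filtration on `D(h^reg) ∗ G` -/

section Filtration

variable {k h G : Type*} [Field k] [AddCommGroup h] [Module k h] [FiniteDimensional k h]
  [Group G] [Fintype G] {n : ℕ} (ρ : Representation k G h) (α : G → Module.Dual k h)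
  (hα : ∀ s ∈ pseudoReflections ρ,
    LinearMap.ker (α s) = LinearMap.ker (LinearMap.id - ρ s))

/-- The skew group algebra `D(h^reg) ∗ G`. -/
abbrev RegSkew : Type _ := SkewGroupAlgebra (regAction ρ α hα)

/-- The inclusion of `D(h)` in `D(h^reg) ∗ G`. -/
abbrev diffW : DiffOp k h →ₐ[k] RegSkew ρ α hα := (inclAlg (regAction ρ α hα)).comp (toReg ρ α)

/-- The inclusion of the polynomial functions in `D(h^reg) ∗ G`. -/
abbrev polyW : SymmetricAlgebra k (Module.Dual k h) →ₐ[k] RegSkew ρ α hα :=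
  (inclAlg (regAction ρ α hα)).comp (polyR ρ α)

/-- The inclusion of the group in `D(h^reg) ∗ G`. -/
abbrev grpW : G →* RegSkew ρ α hα := inclGrp (regAction ρ α hα)

theorem polyW_apply (p : SymmetricAlgebra k (Module.Dual k h)) :
    polyW ρ α hα p = diffW ρ α hα (polyD p) := rfl

theorem grpW_mul_diffW (g : G) (a : DiffOp k h) :
    grpW ρ α hα g * diffW ρ α hα a = diffW ρ α hα (diffAction ρ g a) * grpW ρ α hα g := by
  rw [AlgHom.comp_apply, inclGrp_mul_inclAlg]
  exact congrArg (fun x => inclAlg (regAction ρ α hα) x * grpW ρ α hα g)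
    (regMap_toReg ρ α hα g a)

theorem inclAlg_mul_grpW (a : DiffReg ρ α) (g : G) :
    inclAlg (regAction ρ α hα) a * grpW ρ α hα g
      = SkewMonoidAlgebra.single g (a : WithAction (regAction ρ α hα)) := by
  change (SkewMonoidAlgebra.single (1 : G) (show WithAction (regAction ρ α hα) from a) :
      RegSkew ρ α hα) * SkewMonoidAlgebra.single g (1 : WithAction (regAction ρ α hα)) = _
  rw [SkewMonoidAlgebra.single_mul_single, one_mul, smul_one, mul_one]
  rfl

theorem regSkew_induction {P : RegSkew ρ α hα → Prop}
    (hmul : ∀ a g, P (inclAlg (regAction ρ α hα) a * grpW ρ α hα g))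
    (hadd : ∀ w w', P w → P w' → P (w + w')) (w : RegSkew ρ α hα) : P w := by
  induction w using SkewMonoidAlgebra.induction_on' with
  | single g x => exact (congrArg P (inclAlg_mul_grpW ρ α hα x g)).mp (hmul x g)
  | add w w' hw hw' => exact hadd w w' hw hw'

/-- The coefficient of `g` in an element of `D(h^reg) ∗ G`. -/
def coeffW (g : G) : RegSkew ρ α hα →ₗ[k] DiffReg ρ α where
  toFun w := w.coeff g
  map_add' _ _ := by rw [SkewMonoidAlgebra.coeff_add]; rfl
  map_smul' _ _ := by rw [SkewMonoidAlgebra.coeff_smul]; rfl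

theorem coeffW_inclAlg_mul_grpW [DecidableEq G] (a : DiffReg ρ α) (g g' : G) :
    coeffW ρ α hα g' (inclAlg (regAction ρ α hα) a * grpW ρ α hα g) = if g = g' then a else 0 := by
  rw [inclAlg_mul_grpW]
  change (SkewMonoidAlgebra.single g (a : WithAction (regAction ρ α hα))).coeff g' = _
  rw [SkewMonoidAlgebra.coeff_single_apply]

theorem regSkew_ext {w w' : RegSkew ρ α hα} (H : ∀ g, coeffW ρ α hα g w = coeffW ρ α hα g w') :
    w = w' := SkewMonoidAlgebra.ext H

/-- The normally ordered monomials `∂^β g` of `D(h^reg) ∗ G`. -/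
def monW (b : Module.Basis (Fin n) k h) (x : (Fin n →₀ ℕ) × G) : RegSkew ρ α hα :=
  diffW ρ α hα (constD (symMonomial b x.1)) * grpW ρ α hα x.2

/-- The normal ordering map `∑ p_{β,g} ξ^β g ↦ ∑ p_{β,g} ∂^β g`. -/
abbrev skewOrder (b : Module.Basis (Fin n) k h) :
    ((Fin n →₀ ℕ) × G →₀ SymmetricAlgebra k (Module.Dual k h)) →ₗ[k] RegSkew ρ α hα :=
  normalOrder (polyW ρ α hα) (monW ρ α hα b)

/-- `D(h^reg) ∗ G` is free over `D(h^reg)` on `G`, so the coefficients of each `g` can be compared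
separately, inside `D(h)`. -/
theorem skewOrder_injective (b : Module.Basis (Fin n) k h) :
    Function.Injective (skewOrder ρ α hα b) := by
  classical
  let slice (g : G) : ((Fin n →₀ ℕ) × G →₀ SymmetricAlgebra k (Module.Dual k h)) →ₗ[k]
      ((Fin n →₀ ℕ) →₀ SymmetricAlgebra k (Module.Dual k h)) :=
    Finsupp.lcomapDomain (fun β => (β, g)) (Prod.mk_left_injective g)
  have key : ∀ g z, coeffW ρ α hα g (skewOrder ρ α hα b z)
      = toReg ρ α (weylOrder b (slice g z)) := by
    intro g z
    induction z using Finsupp.induction_linear with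
    | zero => simp
    | add z z' hz hz' => simp only [map_add, hz, hz']
    | single x p =>
      obtain ⟨β, g'⟩ := x
      have hs : slice g (Finsupp.single (β, g') p) = if g' = g then Finsupp.single β p else 0 := by
        ext γ
        change Finsupp.single (β, g') p (γ, g) = _
        by_cases hg : g' = g
        · subst hg
          by_cases hβ : β = γ
          · subst hβ; simp
          · rw [if_pos rfl, Finsupp.single_eq_of_ne (by simpa using Ne.symm hβ),
              Finsupp.single_eq_of_ne (Ne.symm hβ)]
        · rw [if_neg hg, Finsupp.single_eq_of_ne (by simp [Ne.symm hg])]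
          rfl
      rw [normalOrder_single, hs, monW, polyW_apply, ← mul_assoc, ← map_mul, AlgHom.comp_apply,
        coeffW_inclAlg_mul_grpW]
      split_ifs
      · rw [normalOrder_single]
      · simp
  rw [injective_iff_map_eq_zero]
  intro z hz
  ext ⟨β, g⟩
  have h1 := key g z
  rw [hz, map_zero] at h1
  have h2 : weylOrder b (slice g z) = 0 := toReg_injective ρ α hα (h1.symm.trans (map_zero _).symm)
  have h3 : slice g z = 0 := weylOrder_injective b (h2.trans (map_zero _).symm)
  exact DFunLike.congr_fun h3 β

/-- Subspaces of `D(h^reg) ∗ G` stable under left multiplication by `k[h]` and `δ⁻¹`. -/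
structure IsRegStable (N : Submodule k (RegSkew ρ α hα)) : Prop where
  poly_mul_mem : ∀ (p : SymmetricAlgebra k (Module.Dual k h)), ∀ w ∈ N, polyW ρ α hα p * w ∈ N
  of_delta_mul_mem : ∀ w, polyW ρ α hα (delta ρ α) * w ∈ N → w ∈ N

variable {ρ α hα}

theorem IsRegStable.of_delta_pow_mul_mem {N : Submodule k (RegSkew ρ α hα)}
    (hN : IsRegStable ρ α hα N) (j : ℕ) {w : RegSkew ρ α hα}
    (hw : polyW ρ α hα (delta ρ α) ^ j * w ∈ N) : w ∈ N := by
  induction j generalizing w with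
  | zero => simpa using hw
  | succ j ih => exact hN.of_delta_mul_mem _ (ih (by rwa [← mul_assoc, ← pow_succ]))

theorem IsRegStable.skewOrder_mem {N : Submodule k (RegSkew ρ α hα)}
    (hN : IsRegStable ρ α hα N) (b : Module.Basis (Fin n) k h)
    {z : (Fin n →₀ ℕ) × G →₀ SymmetricAlgebra k (Module.Dual k h)}
    (hz : ∀ x ∈ z.support, monW ρ α hα b x ∈ N) : skewOrder ρ α hα b z ∈ N := by
  rw [← Finsupp.sum_single z, Finsupp.sum, map_sum]
  refine N.sum_mem fun x hx => ?_
  rw [normalOrder_single]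
  exact hN.poly_mul_mem _ _ (hz x hx)

/-- Polynomial multiples of the monomials give `D(h) g`, dividing by powers of `δ` gives `D(h^reg)
g`, and sums over `g` give everything. -/
theorem IsRegStable.eq_top {N : Submodule k (RegSkew ρ α hα)}
    (hN : IsRegStable ρ α hα N) (b : Module.Basis (Fin n) k h)
    (hmon : ∀ x, monW ρ α hα b x ∈ N) : N = ⊤ := by
  rw [eq_top_iff]
  rintro w -
  have hD : ∀ (a : DiffOp k h) (g : G), diffW ρ α hα a * grpW ρ α hα g ∈ N := by
    intro a g
    obtain ⟨z, rfl⟩ := weylOrder_surjective b a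
    induction z using Finsupp.induction_linear with
    | zero => simp
    | add z z' hz hz' => rw [map_add, map_add, add_mul]; exact N.add_mem hz hz'
    | single β p =>
      rw [normalOrder_single, map_mul, mul_assoc]
      exact hN.poly_mul_mem _ _ (hmon (β, g))
  have hR : ∀ (a : DiffReg ρ α) (g : G), inclAlg (regAction ρ α hα) a * grpW ρ α hα g ∈ N := by
    intro a g
    obtain ⟨j, r, hr⟩ := exists_delta_pow_mul ρ α a
    refine hN.of_delta_pow_mul_mem j ?_
    rw [← mul_assoc, AlgHom.comp_apply, ← map_pow, ← map_mul, hr]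
    exact hD r g
  induction w using regSkew_induction with
  | hmul a g => exact hR a g
  | hadd w w' hw hw' => exact N.add_mem hw hw'

theorem isUnit_polyW_delta : IsUnit (polyW ρ α hα (delta ρ α)) :=
  (isUnit_polyR_delta ρ α).map (inclAlg (regAction ρ α hα))

variable (ρ α hα)

/-- The elements of `D(h^reg) ∗ G` of order less than `m` in the `∂/∂y_i`. -/
def orderLT (b : Module.Basis (Fin n) k h) (m : ℕ) : Submodule k (RegSkew ρ α hα) where
  carrier := {w | ∃ (N : ℕ),
    ∃ z ∈ Finsupp.supported (SymmetricAlgebra k (Module.Dual k h))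
      (SymmetricAlgebra k (Module.Dual k h)) {x : (Fin n →₀ ℕ) × G | x.1.degree < m},
    polyW ρ α hα (delta ρ α) ^ N * w = skewOrder ρ α hα b z}
  zero_mem' := ⟨0, 0, Submodule.zero_mem _, by simp⟩
  add_mem' := by
    rintro w w' ⟨N, z, hz, hw⟩ ⟨N', z', hz', hw'⟩
    refine ⟨N + N', delta ρ α ^ N' • z + delta ρ α ^ N • z',
      Submodule.add_mem _ (Submodule.smul_mem _ _ hz) (Submodule.smul_mem _ _ hz'), ?_⟩
    rw [map_add, normalOrder_smul, normalOrder_smul, ← hw, ← hw', mul_add, map_pow, map_pow,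
      ← mul_assoc, ← mul_assoc, ← pow_add, ← pow_add, add_comm N']
  smul_mem' := by
    rintro r w ⟨N, z, hz, hw⟩
    refine ⟨N, algebraMap k _ r • z, Submodule.smul_mem _ _ hz, ?_⟩
    rw [normalOrder_smul, AlgHom.commutes, ← hw, mul_smul_comm, Algebra.smul_def]

/-- No exponent has negative degree; this starts the inductions on the order. -/
theorem orderLT_zero (b : Module.Basis (Fin n) k h) : orderLT ρ α hα b 0 = ⊥ := by
  rw [eq_bot_iff]
  rintro w ⟨N, z, hz, hw⟩
  have h0 : z = 0 := by
    have : {x : (Fin n →₀ ℕ) × G | x.1.degree < 0} = ∅ := by ext; simp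
    rw [this, Finsupp.supported_empty] at hz
    exact hz
  rw [h0, map_zero] at hw
  exact ((isUnit_polyW_delta.pow N).mul_right_eq_zero).1 hw

theorem orderLT_isRegStable (b : Module.Basis (Fin n) k h) (m : ℕ) :
    IsRegStable ρ α hα (orderLT ρ α hα b m) where
  poly_mul_mem := by
    rintro p w ⟨N, z, hz, hw⟩
    refine ⟨N, p • z, Submodule.smul_mem _ _ hz, ?_⟩
    rw [normalOrder_smul, ← hw, ← mul_assoc, ← mul_assoc, ← map_pow, ← map_mul, mul_comm, map_mul]
  of_delta_mul_mem := by
    rintro w ⟨N, z, hz, hw⟩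
    exact ⟨N + 1, z, hz, by rw [pow_succ, mul_assoc, hw]⟩

theorem monW_mem_orderLT (b : Module.Basis (Fin n) k h) {m : ℕ} {x : (Fin n →₀ ℕ) × G}
    (hx : x.1.degree < m) : monW ρ α hα b x ∈ orderLT ρ α hα b m :=
  ⟨0, Finsupp.single x 1, Finsupp.single_mem_supported _ _ hx, by simp [normalOrder_single]⟩

/-- Minimality of the filtration step among stable subspaces. Together with
`IsRegStable.comap_mulRight` it reduces statements on right multiplication to monomials. -/
theorem orderLT_le {b : Module.Basis (Fin n) k h} {m : ℕ} {N : Submodule k (RegSkew ρ α hα)}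
    (hN : IsRegStable ρ α hα N)
    (hmon : ∀ x : (Fin n →₀ ℕ) × G, x.1.degree < m → monW ρ α hα b x ∈ N) :
    orderLT ρ α hα b m ≤ N := by
  rintro w ⟨j, z, hz, hw⟩
  refine hN.of_delta_pow_mul_mem j ?_
  rw [hw]
  exact hN.skewOrder_mem b fun x hx => hmon x (hz hx)

theorem orderLT_mono (b : Module.Basis (Fin n) k h) : Monotone (orderLT ρ α hα b) :=
  fun _ m' hm => orderLT_le ρ α hα (orderLT_isRegStable ρ α hα b m')
    fun _ hx => monW_mem_orderLT ρ α hα b (hx.trans_le hm)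

theorem IsRegStable.comap_mulRight {N : Submodule k (RegSkew ρ α hα)}
    (hN : IsRegStable ρ α hα N) (v : RegSkew ρ α hα) :
    IsRegStable ρ α hα (N.comap (LinearMap.mulRight k v)) where
  poly_mul_mem p w hw := by
    simp only [Submodule.mem_comap, LinearMap.mulRight_apply, mul_assoc] at hw ⊢
    exact hN.poly_mul_mem p _ hw
  of_delta_mul_mem w hw := by
    simp only [Submodule.mem_comap, LinearMap.mulRight_apply, mul_assoc] at hw ⊢
    exact hN.of_delta_mul_mem _ hw

theorem mul_mem_orderLT {b : Module.Basis (Fin n) k h} {m m' : ℕ} {v : RegSkew ρ α hα}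
    (hv : ∀ x : (Fin n →₀ ℕ) × G, x.1.degree < m →
      monW ρ α hα b x * v ∈ orderLT ρ α hα b m')
    {w : RegSkew ρ α hα} (hw : w ∈ orderLT ρ α hα b m) : w * v ∈ orderLT ρ α hα b m' :=
  orderLT_le ρ α hα ((orderLT_isRegStable ρ α hα b m').comap_mulRight ρ α hα v) hv hw

theorem mul_grpW_mem_orderLT {b : Module.Basis (Fin n) k h} {m : ℕ} (g : G)
    {w : RegSkew ρ α hα} (hw : w ∈ orderLT ρ α hα b m) :
    w * grpW ρ α hα g ∈ orderLT ρ α hα b m := by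
  refine mul_mem_orderLT ρ α hα (fun x hx => ?_) hw
  rw [monW, mul_assoc, ← map_mul]
  exact monW_mem_orderLT ρ α hα b (x := (x.1, x.2 * g)) hx

theorem monW_mul_partial (b : Module.Basis (Fin n) k h) (β : Fin n →₀ ℕ) (i : Fin n) :
    diffW ρ α hα (constD (symMonomial b β)) * diffW ρ α hα (partialD (b i))
      = diffW ρ α hα (constD (symMonomial b (β + Finsupp.single i 1))) := by
  rw [symMonomial_add_single, map_mul, map_mul, constD_ι]

theorem mul_partial_mem_orderLT {b : Module.Basis (Fin n) k h} {m : ℕ} (u : h)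
    {w : RegSkew ρ α hα} (hw : w ∈ orderLT ρ α hα b m) :
    w * diffW ρ α hα (partialD u) ∈ orderLT ρ α hα b (m + 1) := by
  refine mul_mem_orderLT ρ α hα (fun x hx => ?_) hw
  -- Moving `∂_u` to the left of `g` turns it into `∂_{gu}`, a combination of the `∂_i`, each
  -- raising the degree by one.
  rw [monW, mul_assoc, grpW_mul_diffW, diffAction_partialD, ← b.sum_repr (ρ x.2 u), map_sum,
    map_sum, Finset.sum_mul, Finset.mul_sum]
  refine Submodule.sum_mem _ fun i _ => ?_
  rw [map_smul, map_smul, smul_mul_assoc, mul_smul_comm, ← mul_assoc, monW_mul_partial]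
  refine Submodule.smul_mem _ _ (monW_mem_orderLT ρ α hα b
    (x := (x.1 + Finsupp.single i 1, x.2)) ?_)
  simpa using hx

/-- Functions have order zero on the right as well. The induction on `β` uses `∂^β ∂_i a = ∂^β a ∂_i
+ ∂^β a'`, with `a'` the derivative of `a`. -/
theorem mul_regFun_mem_orderLT {b : Module.Basis (Fin n) k h} {m : ℕ} {a : DiffReg ρ α}
    (ha : a ∈ regFun ρ α) {w : RegSkew ρ α hα} (hw : w ∈ orderLT ρ α hα b m) :
    w * inclAlg (regAction ρ α hα) a ∈ orderLT ρ α hα b m := by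
  have key : ∀ (β : Fin n →₀ ℕ), ∀ a ∈ regFun ρ α,
      diffW ρ α hα (constD (symMonomial b β)) * inclAlg (regAction ρ α hα) a
        ∈ orderLT ρ α hα b (β.degree + 1) := by
    intro β
    induction β using exponent_induction with
    | h0 =>
      rintro a ⟨N, p, hp⟩
      refine ⟨N, Finsupp.single (0, 1) p, Finsupp.single_mem_supported _ _ (by simp), ?_⟩
      rw [normalOrder_single, monW, symMonomial_zero, map_one, map_one, one_mul, map_one, mul_one,
        AlgHom.comp_apply, ← map_pow, ← map_mul, hp, mul_one, AlgHom.comp_apply (inclAlg _)]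
    | hadd β i ih =>
      intro a ha
      obtain ⟨a', ha', he⟩ := partialD_regFun ρ α (b i) ha
      have h1 : diffW ρ α hα (partialD (b i)) * inclAlg (regAction ρ α hα) a
          = inclAlg (regAction ρ α hα) a * diffW ρ α hα (partialD (b i))
            + inclAlg (regAction ρ α hα) a' := by
        rw [AlgHom.comp_apply, ← map_mul, he, map_add, map_mul]
      have h2 : (β + Finsupp.single i 1).degree = β.degree + 1 := by simp
      rw [← monW_mul_partial, mul_assoc, h1, mul_add, ← mul_assoc, h2]
      exact Submodule.add_mem _ (mul_partial_mem_orderLT ρ α hα _ (ih a ha))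
        (orderLT_mono ρ α hα b (Nat.le_succ _) (ih a' ha'))
  refine mul_mem_orderLT ρ α hα (fun x hx => ?_) hw
  rw [monW, mul_assoc, inclGrp_mul_inclAlg, ← mul_assoc]
  exact mul_grpW_mem_orderLT ρ α hα _ (orderLT_mono ρ α hα b hx
    (key x.1 _ (regMap_mem_regFun ρ α hα x.2 ha)))

end Filtration

/-! ### Roots and coroots of pseudo-reflections -/

section Reflections

variable {k h G : Type*} [Field k] [AddCommGroup h] [Module k h] [FiniteDimensional k h]
  [Group G] [Fintype G] {ρ : Representation k G h} {α : G → Module.Dual k h}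

theorem rep_apply_inv (ρ : Representation k G h) (g : G) (v : h) : ρ g (ρ g⁻¹ v) = v := by
  rw [← Module.End.mul_apply, ← map_mul]; simp

theorem rep_inv_apply (ρ : Representation k G h) (g : G) (v : h) : ρ g⁻¹ (ρ g v) = v := by
  rw [← Module.End.mul_apply, ← map_mul]; simp

theorem conj_mem_pseudoReflections {s : G} (hs : s ∈ pseudoReflections ρ) (g : G) :
    g * s * g⁻¹ ∈ pseudoReflections ρ := by
  simp only [elementsOfRank, Finset.mem_filter, Finset.mem_univ, true_and] at hs ⊢
  rw [← hs]
  let e : h ≃ₗ[k] h := LinearEquiv.ofLinearMap (ρ g) (ρ g⁻¹)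
    (LinearMap.ext (rep_apply_inv ρ g)) (LinearMap.ext (rep_inv_apply ρ g))
  have h1 : LinearMap.range (LinearMap.id - ρ (g * s * g⁻¹))
      = (LinearMap.range (LinearMap.id - ρ s)).map (e : h →ₗ[k] h) := by
    have : LinearMap.id - ρ (g * s * g⁻¹)
        = (e : h →ₗ[k] h) ∘ₗ (LinearMap.id - ρ s) ∘ₗ (e.symm : h →ₗ[k] h) := by
      ext v
      simp [e]
    rw [this, LinearMap.range_comp, LinearMap.range_comp, LinearEquiv.range, Submodule.map_top]
  rw [h1, LinearEquiv.finrank_map_eq]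

variable (hα : ∀ s ∈ pseudoReflections ρ,
  LinearMap.ker (α s) = LinearMap.ker (LinearMap.id - ρ s))
include hα

theorem root_eq_zero_iff {s : G} (hs : s ∈ pseudoReflections ρ) (v : h) :
    α s v = 0 ↔ ρ s v = v := by
  have := SetLike.ext_iff.1 (hα s hs) v
  simp only [LinearMap.mem_ker, LinearMap.sub_apply, LinearMap.id_apply, sub_eq_zero] at this
  rw [this, eq_comm]

theorem exists_coroot {s : G} (hs : s ∈ pseudoReflections ρ) :
    ∃ a : h, ∀ v, v - ρ s⁻¹ v = α s v • a := by
  obtain ⟨v₀, hv₀⟩ : ∃ v, α s v ≠ 0 := by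
    by_contra! hcon
    exact root_ne_zero ρ α hα hs (LinearMap.ext hcon)
  refine ⟨(α s v₀)⁻¹ • (v₀ - ρ s⁻¹ v₀), fun v => ?_⟩
  -- Subtracting a multiple of `v₀` moves `v` into the reflecting hyperplane, on which `1 - s⁻¹`
  -- vanishes.
  have h1 : ρ s (v - (α s v * (α s v₀)⁻¹) • v₀) = v - (α s v * (α s v₀)⁻¹) • v₀ := by
    rw [← root_eq_zero_iff hα hs]
    simp [hv₀]
  have h2 := congrArg (ρ s⁻¹) h1
  rw [rep_inv_apply, map_sub, map_smul] at h2
  rw [smul_smul, smul_sub, sub_eq_sub_iff_sub_eq_sub]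
  exact h2

omit hα in
variable (ρ α) in
/-- The vector `a_s` with `v - s⁻¹ v = α_s(v) a_s`. -/
def coroot (s : G) : h :=
  open Classical in
  if H : ∃ a : h, ∀ v, v - ρ s⁻¹ v = α s v • a then H.choose else 0

theorem coroot_spec {s : G} (hs : s ∈ pseudoReflections ρ) (v : h) :
    v - ρ s⁻¹ v = α s v • coroot ρ α s := by
  have H := exists_coroot hα hs
  rw [coroot, dif_pos H]
  exact H.choose_spec v

theorem rep_inv_eq {s : G} (hs : s ∈ pseudoReflections ρ) (v : h) :
    ρ s⁻¹ v = v - α s v • coroot ρ α s := by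
  rw [← coroot_spec hα hs, sub_sub_cancel]

theorem dual_eq {s : G} (hs : s ∈ pseudoReflections ρ) (f : Module.Dual k h) :
    ρ.dual s f = f - f (coroot ρ α s) • α s := by
  ext v
  change f (ρ s⁻¹ v) = _
  rw [rep_inv_eq hα hs]
  simp [mul_comm]

theorem coroot_ne_zero {s : G} (hs : s ∈ pseudoReflections ρ) : coroot ρ α s ≠ 0 := by
  intro h0
  apply root_ne_zero ρ α hα hs
  ext v
  rw [LinearMap.zero_apply, root_eq_zero_iff hα hs]
  have h1 := coroot_spec hα hs (ρ s v)
  rw [h0, smul_zero, rep_inv_apply, sub_eq_zero] at h1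
  exact h1

/-- Otherwise `a_s` would lie both in the kernel and in the image of `1 - s`. The projection
`reflProj`, available as the order of `s` is invertible, is zero on the former and the identity on
the latter. -/
theorem root_coroot_ne_zero {s : G} (hs : s ∈ pseudoReflections ρ) (ho : (orderOf s : k) ≠ 0) :
    α s (coroot ρ α s) ≠ 0 := by
  intro h0
  apply coroot_ne_zero hα hs
  have h1 : coroot ρ α s ∈ LinearMap.ker (LinearMap.id - ρ s) := by
    rw [← hα s hs]; exact h0
  obtain ⟨v, hv⟩ : ∃ v, α s v ≠ 0 := by
    by_contra! hcon
    exact root_ne_zero ρ α hα hs (LinearMap.ext hcon)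
  have h2 : coroot ρ α s ∈ LinearMap.range (LinearMap.id - ρ s) := by
    -- This works because `(1 - s)(-s⁻¹ v) = v - s⁻¹ v = α_s(v) a_s`.
    refine ⟨-(α s v)⁻¹ • ρ s⁻¹ v, ?_⟩
    rw [← inv_smul_smul₀ hv (coroot ρ α s), ← coroot_spec hα hs]
    simp [smul_sub]
    abel
  rw [← reflProj_of_mem_range ρ s _ h2, reflProj_of_mem_ker ρ s ho _ h1]

/-- The image of `1 - s` on `h ⊕ h*` is spanned by `a_s` and `α_s`, so the projection onto it is
explicit. Dividing by `α_s(a_s)` makes the formula independent of the scaling of `α_s`. -/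
theorem reflForm_doubleRep {s : G} (hs : s ∈ pseudoReflections ρ) (ho : (orderOf s : k) ≠ 0)
    (x y : h × Module.Dual k h) :
    reflForm (doubleRep ρ) (canonicalForm k h) s x y
      = (α s x.1 * y.2 (coroot ρ α s) - α s y.1 * x.2 (coroot ρ α s))
        / α s (coroot ρ α s) := by
  have hl := root_coroot_ne_zero hα hs ho
  have key : ∀ x : h × Module.Dual k h, reflProj (doubleRep ρ) s x
      = ((α s x.1 / α s (coroot ρ α s)) • coroot ρ α s,
          (x.2 (coroot ρ α s) / α s (coroot ρ α s)) • α s) := by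
    intro x
    set x' : h × Module.Dual k h := ((α s x.1 / α s (coroot ρ α s)) • coroot ρ α s,
      (x.2 (coroot ρ α s) / α s (coroot ρ α s)) • α s) with hx'
    have h1 : x - x' ∈ LinearMap.ker (LinearMap.id - doubleRep ρ s) := by
      rw [LinearMap.mem_ker, LinearMap.sub_apply, LinearMap.id_apply, sub_eq_zero,
        Representation.prod_apply_apply]
      apply Prod.ext
      · change x.1 - _ = ρ s (x.1 - _)
        rw [eq_comm, ← root_eq_zero_iff hα hs]
        simp [hx', hl]
      · change x.2 - _ = ρ.dual s (x.2 - _)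
        rw [dual_eq hα hs]
        simp [hx', hl]
    have h2 : x' ∈ LinearMap.range (LinearMap.id - doubleRep ρ s) := by
      refine ⟨(-((α s x.1 / α s (coroot ρ α s) / α s (coroot ρ α s)) •
          ρ s⁻¹ (coroot ρ α s)),
        (x.2 (coroot ρ α s) / α s (coroot ρ α s) / α s (coroot ρ α s)) • α s), ?_⟩
      rw [LinearMap.sub_apply, LinearMap.id_apply, Representation.prod_apply_apply]
      apply Prod.ext
      · change -(_ • _) - ρ s (-(_ • _)) = _ • _
        rw [map_neg, map_smul, rep_apply_inv, neg_sub_neg, ← smul_sub, coroot_spec hα hs,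
          smul_smul, div_mul_cancel₀ _ hl]
      · change _ - ρ.dual s _ = _ • _
        rw [dual_eq hα hs]
        simp [hl]
    rw [← sub_add_cancel x x', map_add, reflProj_of_mem_ker _ s ho _ h1,
      reflProj_of_mem_range _ s _ h2, zero_add]
  rw [reflForm, LinearMap.compl₁₂_apply, key, key, canonicalForm_apply]
  simp only [LinearMap.smul_apply, map_smul, smul_eq_mul]
  field_simp

/-- The rank-one operators `1 - (g s g⁻¹)⁻¹` and `g (1 - s⁻¹) g⁻¹` coincide, so their factorisations
into a form and a vector differ by a scalar `t` and its inverse. The `α_s` are chosen independently,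
hence `t` need not be `1`. -/
theorem exists_conj_root {s : G} (hs : s ∈ pseudoReflections ρ) (ho : (orderOf s : k) ≠ 0)
    (g : G) : ∃ t : k, t ≠ 0 ∧ α (g * s * g⁻¹) = t • ρ.dual g (α s) ∧
      ρ g (coroot ρ α s) = t • coroot ρ α (g * s * g⁻¹) := by
  have hs' := conj_mem_pseudoReflections hs g
  have hl := root_coroot_ne_zero hα hs ho
  have key : ∀ v, α s (ρ g⁻¹ v) • ρ g (coroot ρ α s)
      = α (g * s * g⁻¹) v • coroot ρ α (g * s * g⁻¹) := by
    intro v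
    rw [← map_smul, ← coroot_spec hα hs, ← coroot_spec hα hs', map_sub, rep_apply_inv]
    simp [mul_assoc]
  -- Evaluating at `g a_s` makes the left coefficient `α_s(a_s)`, which is invertible, and so
  -- determines `t`.
  have h1 := key (ρ g (coroot ρ α s))
  rw [rep_inv_apply, ← eq_inv_smul_iff₀ hl, smul_smul] at h1
  refine ⟨_, ?_, ?_, h1⟩
  · intro h0
    rw [h0, zero_smul] at h1
    apply coroot_ne_zero hα hs
    rw [← rep_inv_apply ρ g (coroot ρ α s), h1, map_zero]
  · ext v
    have h2 := key v
    rw [h1, smul_smul] at h2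
    have h3 := smul_left_injective k (coroot_ne_zero hα hs') h2
    rw [← h3, mul_comm]
    rfl

theorem root_coroot_conj {s : G} (hs : s ∈ pseudoReflections ρ) (ho : (orderOf s : k) ≠ 0)
    (g : G) : α (g * s * g⁻¹) (coroot ρ α (g * s * g⁻¹)) = α s (coroot ρ α s) := by
  obtain ⟨t, ht, h1, h2⟩ := exists_conj_root hα hs ho g
  rw [← inv_smul_eq_iff₀ ht] at h2
  rw [← h2, h1]
  change t * α s (ρ g⁻¹ _) = _
  rw [map_smul, rep_inv_apply, map_smul, smul_eq_mul, mul_inv_cancel_left₀ ht]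

/-- With `t = s⁻¹` one has `α_t(u) a_t = u - s u = -α_s(u) s a_s`, so `α_s` and `α_t` are
proportional. -/
theorem root_mul_root_inv {s t : G} (hs : s ∈ pseudoReflections ρ)
    (ht : t ∈ pseudoReflections ρ) (hst : s * t = 1) (u v : h) :
    α s u * α t v = α s v * α t u := by
  have key : ∀ u, α t u • coroot ρ α t = -(α s u • ρ s (coroot ρ α s)) := by
    intro u
    rw [← coroot_spec hα ht, ← map_smul, ← coroot_spec hα hs, map_sub, rep_apply_inv,
      inv_eq_of_mul_eq_one_left hst, neg_sub]
  apply smul_left_injective k (coroot_ne_zero hα ht)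
  simp only [mul_smul, key, smul_neg]
  rw [smul_comm]

end Reflections

/-! ### Dunkl elements and their commutativity -/

section Dunkl

variable {k h G : Type*} [Field k] [AddCommGroup h] [Module k h] [FiniteDimensional k h]
  [Group G] [Fintype G] (ρ : Representation k G h) (α : G → Module.Dual k h)
  (hα : ∀ s ∈ pseudoReflections ρ,
    LinearMap.ker (α s) = LinearMap.ker (LinearMap.id - ρ s))

/-- The element `α_s⁻¹ s` of `D(h^reg) ∗ G`. -/
def rootInvRefl (s : G) : RegSkew ρ α hα :=
  inclAlg (regAction ρ α hα) (rootInv ρ α s) * grpW ρ α hα s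

/-- The element `∑_s c_s / α_s(a_s) α_s(u) α_s⁻¹ s` of `D(h^reg) ∗ G`. -/
def dunklTail (c : G → k) : h →ₗ[k] RegSkew ρ α hα :=
  ∑ s ∈ pseudoReflections ρ,
    (α s).smulRight ((c s / α s (coroot ρ α s)) • rootInvRefl ρ α hα s)

/-- The Dunkl element attached to a vector of `h`. -/
def dunkl (c : G → k) : h →ₗ[k] RegSkew ρ α hα :=
  (diffW ρ α hα).toLinearMap ∘ₗ partialD + dunklTail ρ α hα c

theorem dunklTail_apply (c : G → k) (u : h) : dunklTail ρ α hα c u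
    = ∑ s ∈ pseudoReflections ρ,
      (α s u * (c s / α s (coroot ρ α s))) • rootInvRefl ρ α hα s := by
  simp [dunklTail, smul_smul]

theorem dunkl_apply (c : G → k) (u : h) : dunkl ρ α hα c u
    = diffW ρ α hα (partialD u) + dunklTail ρ α hα c u := rfl

theorem dunklTail_mem_rootSpan (c : G → k) (u : h) :
    dunklTail ρ α hα c u ∈ rootSpan ρ α hα := by
  rw [dunklTail_apply]
  refine Submodule.sum_mem _ fun s hs => Submodule.smul_mem _ _ (Submodule.subset_span ?_)
  exact ⟨s, hs, s, rootInv ρ α s, rootInv_mul ρ α hs, mul_rootInv ρ α hs, rfl⟩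

variable {ρ α}

theorem regFun_commute_coordD {a : DiffReg ρ α} (ha : a ∈ regFun ρ α) (f : Module.Dual k h) :
    a * toReg ρ α (coordD f) = toReg ρ α (coordD f) * a := by
  rw [← polyD_ι]
  exact regFun_commute ρ α ha _

/-- Since `s f = (f - f(a_s) α_s) s`, the factor `α_s⁻¹` cancels the root in the correction term. -/
theorem rootInvRefl_mul_coordD {s : G} (hs : s ∈ pseudoReflections ρ) (f : Module.Dual k h) :
    rootInvRefl ρ α hα s * diffW ρ α hα (coordD f)
      = diffW ρ α hα (coordD f) * rootInvRefl ρ α hα s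
        - f (coroot ρ α s) • grpW ρ α hα s := by
  rw [rootInvRefl, mul_assoc, grpW_mul_diffW, diffAction_coordD, dual_eq hα hs, map_sub, map_smul,
    map_sub, map_smul, ← mul_assoc, mul_sub, AlgHom.comp_apply, AlgHom.comp_apply, ← map_mul,
    regFun_commute_coordD (rootInv_mem_regFun ρ α hs), mul_smul_comm, ← map_mul,
    rootInv_mul ρ α hs, map_one, map_mul, sub_mul, smul_mul_assoc, one_mul, mul_assoc]

theorem dunkl_mul_coordD (c : G → k) (u : h) (f : Module.Dual k h) :
    dunkl ρ α hα c u * diffW ρ α hα (coordD f) - diffW ρ α hα (coordD f) * dunkl ρ α hα c u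
      = algebraMap k _ (f u) - ∑ s ∈ pseudoReflections ρ,
        (c s * (α s u * f (coroot ρ α s) / α s (coroot ρ α s))) • grpW ρ α hα s := by
  have h1 : dunklTail ρ α hα c u * diffW ρ α hα (coordD f)
      = diffW ρ α hα (coordD f) * dunklTail ρ α hα c u
        - ∑ s ∈ pseudoReflections ρ,
        (c s * (α s u * f (coroot ρ α s) / α s (coroot ρ α s))) • grpW ρ α hα s := by
    rw [dunklTail_apply, Finset.sum_mul, Finset.mul_sum, ← Finset.sum_sub_distrib]
    refine Finset.sum_congr rfl fun s hs => ?_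
    rw [smul_mul_assoc, rootInvRefl_mul_coordD hα hs, smul_sub, mul_smul_comm, smul_smul]
    congr 2
    ring
  have h2 : diffW ρ α hα (partialD u) * diffW ρ α hα (coordD f)
      = diffW ρ α hα (coordD f) * diffW ρ α hα (partialD u) + algebraMap k _ (f u) := by
    rw [← map_mul, ← map_mul, ← sub_eq_iff_eq_add', ← map_sub, partialD_coordD, AlgHom.commutes]
  rw [dunkl_apply, add_mul, h1, h2, mul_add]
  abel

theorem grpW_mul_rootInvRefl {s : G} (hs : s ∈ pseudoReflections ρ) (g : G) {t : k}
    (h1 : α (g * s * g⁻¹) = t • ρ.dual g (α s)) :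
    grpW ρ α hα g * rootInvRefl ρ α hα s
      = t • (rootInvRefl ρ α hα (g * s * g⁻¹) * grpW ρ α hα g) := by
  have hs' := conj_mem_pseudoReflections hs g
  have h2 : regAction ρ α hα g (rootInv ρ α s) = t • rootInv ρ α (g * s * g⁻¹) := by
    refine (isUnit_root ρ α hs').mul_left_cancel ?_
    rw [mul_smul_comm, mul_rootInv ρ α hs', h1, map_smul, map_smul, smul_mul_assoc]
    congr 1
    rw [← diffAction_coordD, ← regMap_toReg ρ α hα]
    change regAction ρ α hα g _ * _ = _
    rw [← map_mul, mul_rootInv ρ α hs, map_one]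
  rw [rootInvRefl, ← mul_assoc, inclGrp_mul_inclAlg, h2, map_smul, smul_mul_assoc, smul_mul_assoc,
    rootInvRefl, mul_assoc, mul_assoc (inclAlg _ _), ← map_mul, ← map_mul, inv_mul_cancel_right]

theorem grpW_mul_dunkl (c : G → k)
    (hc : ∀ s ∈ pseudoReflections ρ, ∀ g : G, c (g * s * g⁻¹) = c s)
    (ho : ∀ s : G, (orderOf s : k) ≠ 0) (g : G) (u : h) :
    grpW ρ α hα g * dunkl ρ α hα c u = dunkl ρ α hα c (ρ g u) * grpW ρ α hα g := by
  have h1 : grpW ρ α hα g * dunklTail ρ α hα c u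
      = dunklTail ρ α hα c (ρ g u) * grpW ρ α hα g := by
    rw [dunklTail_apply, dunklTail_apply, Finset.sum_mul, Finset.mul_sum]
    -- Conjugation permutes the summands. The scalar `t` from `exists_conj_root` occurs once on each
    -- side: in `g α_s⁻¹ s` on the left and in `α_{gsg⁻¹}(gu)` on the right.
    refine Finset.sum_bij' (fun s _ => g * s * g⁻¹) (fun s _ => g⁻¹ * s * g)
      (fun s hs => conj_mem_pseudoReflections hs g)
      (fun s hs => by simpa using conj_mem_pseudoReflections hs g⁻¹) ?_ ?_ ?_
    · intro s _; group
    · intro s _; group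
    · intro s hs
      obtain ⟨t, ht, ht', -⟩ := exists_conj_root hα hs (ho s) g
      rw [mul_smul_comm, grpW_mul_rootInvRefl hα hs g ht', smul_smul, smul_mul_assoc, hc s hs,
        root_coroot_conj hα hs (ho s)]
      congr 1
      rw [ht']
      change _ = t * α s (ρ g⁻¹ (ρ g u)) * _
      rw [rep_inv_apply]
      ring
  rw [dunkl_apply, dunkl_apply, mul_add, add_mul, h1, grpW_mul_diffW, diffAction_partialD]

/-- Equivariance gives `D_u s = s D_{s⁻¹u}` with `s⁻¹ u = u - α_s(u) a_s`. The factor `α_s(u)` is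
what makes the double commutators below symmetric. -/
theorem dunkl_mul_refl (c : G → k)
    (hc : ∀ s ∈ pseudoReflections ρ, ∀ g : G, c (g * s * g⁻¹) = c s)
    (ho : ∀ s : G, (orderOf s : k) ≠ 0) {s : G} (hs : s ∈ pseudoReflections ρ) (u : h) :
    dunkl ρ α hα c u * grpW ρ α hα s - grpW ρ α hα s * dunkl ρ α hα c u
      = -(α s u • (grpW ρ α hα s * dunkl ρ α hα c (coroot ρ α s))) := by
  have h1 := grpW_mul_dunkl hα c hc ho s (ρ s⁻¹ u)
  rw [rep_apply_inv] at h1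
  rw [← h1, rep_inv_eq hα hs, map_sub, map_smul, mul_sub, mul_smul_comm]
  abel

/-- By the Jacobi identity it suffices that `[D_u, [D_v, f]]` be symmetric in `u` and `v`. Indeed
`[D_v, f]` is a combination of `1` and reflections `s` with coefficients proportional to `α_s(v)`,
and `[D_u, s]` contributes `α_s(u)`. -/
theorem dunkl_commutator_coordD (c : G → k)
    (hc : ∀ s ∈ pseudoReflections ρ, ∀ g : G, c (g * s * g⁻¹) = c s)
    (ho : ∀ s : G, (orderOf s : k) ≠ 0) (u v : h) (f : Module.Dual k h) :
    Commute (dunkl ρ α hα c u * dunkl ρ α hα c v - dunkl ρ α hα c v * dunkl ρ α hα c u)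
      (diffW ρ α hα (coordD f)) := by
  have key : ∀ u v, dunkl ρ α hα c u * (dunkl ρ α hα c v * diffW ρ α hα (coordD f)
        - diffW ρ α hα (coordD f) * dunkl ρ α hα c v)
      - (dunkl ρ α hα c v * diffW ρ α hα (coordD f)
        - diffW ρ α hα (coordD f) * dunkl ρ α hα c v) * dunkl ρ α hα c u
      = ∑ s ∈ pseudoReflections ρ,
        (α s u * α s v * (c s * f (coroot ρ α s) / α s (coroot ρ α s))) •
          (grpW ρ α hα s * dunkl ρ α hα c (coroot ρ α s)) := by
    intro u v
    rw [dunkl_mul_coordD, mul_sub, sub_mul, ← Algebra.commutes, sub_sub_sub_cancel_left,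
      Finset.mul_sum, Finset.sum_mul, ← Finset.sum_sub_distrib]
    refine Finset.sum_congr rfl fun s hs => ?_
    rw [smul_mul_assoc, mul_smul_comm, ← smul_sub, ← neg_sub, dunkl_mul_refl hα c hc ho hs,
      neg_neg, smul_smul]
    congr 1
    ring
  rw [commute_iff_eq, ← sub_eq_zero]
  have h1 := key u v
  have h2 := key v u
  simp only [mul_comm (α _ v)] at h2
  rw [← h2, ← sub_eq_zero] at h1
  rw [← h1]
  noncomm_ring

theorem partialD_rootInvRefl {s : G} (hs : s ∈ pseudoReflections ρ) (u : h) :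
    diffW ρ α hα (partialD u) * rootInvRefl ρ α hα s
        - rootInvRefl ρ α hα s * diffW ρ α hα (partialD u)
      = -(α s u • (inclAlg (regAction ρ α hα) (rootInv ρ α s) * rootInvRefl ρ α hα s
        + rootInvRefl ρ α hα s * diffW ρ α hα (partialD (coroot ρ α s)))) := by
  have h1 : toReg ρ α (partialD u) * rootInv ρ α s
      = rootInv ρ α s * toReg ρ α (partialD u)
        - α s u • (rootInv ρ α s * rootInv ρ α s) := by
    have h2 := congrArg (toReg ρ α) (partialD_coordD u (α s))
    rw [map_sub, map_mul, map_mul, AlgHom.commutes, sub_eq_iff_eq_add] at h2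
    refine (isUnit_root ρ α hs).mul_left_cancel ?_
    refine (isUnit_root ρ α hs).mul_right_cancel ?_
    rw [mul_assoc, mul_assoc, rootInv_mul ρ α hs, mul_one, mul_sub, ← mul_assoc,
      mul_rootInv ρ α hs, one_mul, mul_smul_comm, ← mul_assoc, mul_rootInv ρ α hs, one_mul, sub_mul,
      h2, smul_mul_assoc, rootInv_mul ρ α hs, Algebra.algebraMap_eq_smul_one]
    abel
  have h3 : diffW ρ α hα (partialD u) * grpW ρ α hα s
      = grpW ρ α hα s * diffW ρ α hα (partialD u)
        - α s u • (grpW ρ α hα s * diffW ρ α hα (partialD (coroot ρ α s))) := by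
    have h4 := grpW_mul_diffW ρ α hα s (partialD (ρ s⁻¹ u))
    rw [diffAction_partialD, rep_apply_inv] at h4
    rw [← h4, rep_inv_eq hα hs, map_sub, map_sub, map_smul, map_smul, mul_sub, mul_smul_comm]
  rw [rootInvRefl, ← mul_assoc, AlgHom.comp_apply _ _ (partialD u), ← map_mul, h1, map_sub,
    map_smul, map_mul, map_mul, sub_mul, mul_assoc _ _ (grpW ρ α hα s),
    ← AlgHom.comp_apply _ _ (partialD u), h3]
  simp only [mul_sub, mul_smul_comm, smul_mul_assoc, smul_add, mul_assoc]
  abel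

/-- The bracket `[∂_u, T_v]` depends on `u, v` only through the products `α_s(u) α_s(v)`, so it
cancels against `[∂_v, T_u]`. What remains is free of derivatives. -/
theorem dunkl_commutator_eq (c : G → k) (u v : h) :
    dunkl ρ α hα c u * dunkl ρ α hα c v - dunkl ρ α hα c v * dunkl ρ α hα c u
      = dunklTail ρ α hα c u * dunklTail ρ α hα c v
        - dunklTail ρ α hα c v * dunklTail ρ α hα c u := by
  have key : ∀ u v, diffW ρ α hα (partialD u) * dunklTail ρ α hα c v
        - dunklTail ρ α hα c v * diffW ρ α hα (partialD u)
      = ∑ s ∈ pseudoReflections ρ, -((α s u * α s v * (c s / α s (coroot ρ α s))) •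
        (inclAlg (regAction ρ α hα) (rootInv ρ α s) * rootInvRefl ρ α hα s
          + rootInvRefl ρ α hα s * diffW ρ α hα (partialD (coroot ρ α s)))) := by
    intro u v
    rw [dunklTail_apply, Finset.mul_sum, Finset.sum_mul, ← Finset.sum_sub_distrib]
    refine Finset.sum_congr rfl fun s hs => ?_
    rw [smul_mul_assoc, mul_smul_comm, ← smul_sub, partialD_rootInvRefl hα hs, smul_neg, smul_smul]
    congr 2
    ring
  have h1 := key u v
  have h2 := key v u
  simp only [mul_comm (α _ v)] at h2
  rw [← h2] at h1
  have h3 : diffW ρ α hα (partialD u) * diffW ρ α hα (partialD v)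
      = diffW ρ α hα (partialD v) * diffW ρ α hα (partialD u) := by
    rw [← map_mul, partialD_comm, map_mul]
  rw [sub_eq_iff_eq_add] at h1
  rw [dunkl_apply, dunkl_apply, mul_add, mul_add, add_mul, add_mul, add_mul, add_mul, h1, h3]
  abel

theorem coeffW_inclAlg_mul (a : DiffReg ρ α) (w : RegSkew ρ α hα) (g : G) :
    coeffW ρ α hα g (inclAlg (regAction ρ α hα) a * w) = a * coeffW ρ α hα g w := by
  classical
  induction w using regSkew_induction with
  | hmul x g' =>
    rw [← mul_assoc, ← map_mul, coeffW_inclAlg_mul_grpW,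
      coeffW_inclAlg_mul_grpW]
    split_ifs <;> simp
  | hadd w w' hw hw' => rw [mul_add, map_add, map_add, hw, hw', mul_add]

theorem coeffW_mul_inclAlg (a : DiffReg ρ α) (w : RegSkew ρ α hα) (g : G) :
    coeffW ρ α hα g (w * inclAlg (regAction ρ α hα) a)
      = coeffW ρ α hα g w * regAction ρ α hα g a := by
  classical
  induction w using regSkew_induction with
  | hmul x g' =>
    rw [mul_assoc, inclGrp_mul_inclAlg, ← mul_assoc, ← map_mul,
      coeffW_inclAlg_mul_grpW, coeffW_inclAlg_mul_grpW]
    split_ifs with hg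
    · rw [hg]
    · simp
  | hadd w w' hw hw' => rw [add_mul, map_add, map_add, hw, hw', add_mul]

theorem rootInvRefl_mul_rootInvRefl (s t : G) :
    rootInvRefl ρ α hα s * rootInvRefl ρ α hα t
      = inclAlg (regAction ρ α hα) (rootInv ρ α s * regAction ρ α hα s (rootInv ρ α t))
        * grpW ρ α hα (s * t) := by
  rw [rootInvRefl, rootInvRefl, mul_assoc, ← mul_assoc (grpW ρ α hα s), inclGrp_mul_inclAlg,
    map_mul, map_mul]
  simp only [mul_assoc]

theorem dunklTail_mul (c : G → k) (u v : h) :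
    dunklTail ρ α hα c u * dunklTail ρ α hα c v
      = ∑ s ∈ pseudoReflections ρ, ∑ t ∈ pseudoReflections ρ,
        (α s u * α t v * (c s / α s (coroot ρ α s) * (c t / α t (coroot ρ α t)))) •
          (rootInvRefl ρ α hα s * rootInvRefl ρ α hα t) := by
  rw [dunklTail_apply, dunklTail_apply, Finset.sum_mul_sum]
  refine Finset.sum_congr rfl fun s _ => Finset.sum_congr rfl fun t _ => ?_
  rw [smul_mul_smul_comm]
  congr 1
  ring

theorem coeffW_dunklTail_mul_mem (c : G → k) (u v : h) (g : G) :
    coeffW ρ α hα g (dunklTail ρ α hα c u * dunklTail ρ α hα c v) ∈ regFun ρ α := by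
  classical
  rw [dunklTail_mul, map_sum]
  refine sum_mem fun s hs => ?_
  rw [map_sum]
  refine sum_mem fun t ht => ?_
  rw [map_smul, rootInvRefl_mul_rootInvRefl, coeffW_inclAlg_mul_grpW]
  refine (regFun ρ α).smul_mem ?_ _
  split_ifs
  · exact mul_mem (rootInv_mem_regFun ρ α hs)
      (regMap_mem_regFun ρ α hα s (rootInv_mem_regFun ρ α ht))
  · exact zero_mem _

/-- Only pairs with `s t = 1` contribute to the coefficient of the identity, and for these
`root_mul_root_inv` allows `u` and `v` to be exchanged. -/
theorem coeffW_one_dunklTail_mul (c : G → k) (u v : h) :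
    coeffW ρ α hα 1 (dunklTail ρ α hα c u * dunklTail ρ α hα c v)
      = coeffW ρ α hα 1 (dunklTail ρ α hα c v * dunklTail ρ α hα c u) := by
  classical
  rw [dunklTail_mul, dunklTail_mul, map_sum, map_sum]
  refine Finset.sum_congr rfl fun s hs => ?_
  rw [map_sum, map_sum]
  refine Finset.sum_congr rfl fun t ht => ?_
  rw [map_smul, map_smul, rootInvRefl_mul_rootInvRefl, coeffW_inclAlg_mul_grpW]
  split_ifs with hst
  · rw [root_mul_root_inv hα hs ht hst]
  · rw [smul_zero, smul_zero]

theorem exists_dual_ne (hρ : Function.Injective ρ) {g : G} (hg : g ≠ 1) :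
    ∃ f : Module.Dual k h, ρ.dual g f - f ≠ 0 := by
  by_contra! hcon
  apply hg
  rw [← inv_eq_one]
  apply hρ
  rw [map_one]
  ext v
  rw [Module.End.one_apply, ← sub_eq_zero, ← Module.forall_dual_apply_eq_zero_iff k]
  intro f
  have h1 := LinearMap.congr_fun (hcon f) v
  rw [map_sub]
  exact h1

theorem dunkl_comm (hρ : Function.Injective ρ) (c : G → k)
    (hc : ∀ s ∈ pseudoReflections ρ, ∀ g : G, c (g * s * g⁻¹) = c s)
    (ho : ∀ s : G, (orderOf s : k) ≠ 0) (u v : h) :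
    dunkl ρ α hα c u * dunkl ρ α hα c v = dunkl ρ α hα c v * dunkl ρ α hα c u := by
  rw [← sub_eq_zero]
  apply regSkew_ext
  intro g
  rw [map_zero]
  by_cases hg : g = 1
  · rw [hg, dunkl_commutator_eq, map_sub, coeffW_one_dunklTail_mul, sub_self]
  -- For `g ≠ 1`, comparing coefficients of `g` in `z f = f z` gives `z_g (g f - f) = 0`. Here `z_g`
  -- is a function and `g f - f` a nonzero polynomial, so `z_g = 0`.
  · obtain ⟨f, hf⟩ := exists_dual_ne hρ hg
    have h1 := (dunkl_commutator_coordD hα c hc ho u v f).eq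
    have h2 : coeffW ρ α hα g (dunkl ρ α hα c u * dunkl ρ α hα c v
        - dunkl ρ α hα c v * dunkl ρ α hα c u) ∈ regFun ρ α := by
      rw [dunkl_commutator_eq, map_sub]
      exact sub_mem (coeffW_dunklTail_mul_mem hα c u v g) (coeffW_dunklTail_mul_mem hα c v u g)
    generalize dunkl ρ α hα c u * dunkl ρ α hα c v
        - dunkl ρ α hα c v * dunkl ρ α hα c u = z at h1 h2
    refine regFun_mul_polyR_eq_zero ρ α hα h2 (sym_ι_ne_zero hf) ?_
    have h3 := congrArg (coeffW ρ α hα g) h1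
    rw [AlgHom.comp_apply, coeffW_mul_inclAlg, coeffW_inclAlg_mul,
      ← regFun_commute_coordD h2] at h3
    rw [AlgHom.comp_apply, polyD_ι, map_sub, map_sub, mul_sub, sub_eq_zero, ← h3,
      ← diffAction_coordD]
    congr 1
    exact (regMap_toReg ρ α hα g _).symm

end Dunkl

/-! ### Universal property of the skew group algebra -/

section SkewLift

variable {k A G B : Type*} [Field k] [Ring A] [Algebra k A] [Group G] [Ring B] [Algebra k B]
  (φ : G →* (A →ₐ[k] A)) (F : A →ₐ[k] B) (e : G →* B) (hcomm : ∀ g a, e g * F a = F (φ g a) * e g)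

/-- The universal property of the skew group algebra. -/
def skewLift : SkewGroupAlgebra φ →ₐ[k] B :=
  SkewMonoidAlgebra.liftNCAlgHom (A := WithAction φ) F e fun {a g} => (hcomm g a).symm

theorem skewLift_inclAlg (a : A) : skewLift φ F e hcomm (inclAlg φ a) = F a := by
  refine (SkewMonoidAlgebra.liftNC_single _ _ _ _).trans ?_
  rw [map_one, mul_one]
  rfl

theorem skewLift_inclGrp (g : G) : skewLift φ F e hcomm (inclGrp φ g) = e g := by
  refine (SkewMonoidAlgebra.liftNC_single _ _ _ _).trans ?_
  change F 1 * e g = e g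
  rw [map_one, one_mul]

end SkewLift

/-! ### Generation and universal property of symplectic reflection algebras -/

section SRA

variable {k G V : Type*} [Field k] [Group G] [Fintype G] [AddCommGroup V] [Module k V]
  (ρ : Representation k G V) (ω : LinearMap.BilinForm k V) (t : k) (c : G → k)

theorem sraGrp_mul_sraVec (g : G) (v : V) :
    sraGrp ρ ω t c g * sraVec ρ ω t c v = sraVec ρ ω t c (ρ g v) * sraGrp ρ ω t c g := by
  have h1 := congrArg (RingQuot.mkAlgHom k (SRARel ρ ω t c))
    (inclGrp_mul_inclAlg (tensorAction ρ) g (TensorAlgebra.ι k v))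
  rw [map_mul, map_mul] at h1
  have h2 : tensorAction ρ g (TensorAlgebra.ι k v) = TensorAlgebra.ι k (ρ g v) := by
    simp [tensorAction]
  rw [h2] at h1
  exact h1

/-- A left ideal of a symplectic reflection algebra containing `1` is everything. -/
theorem sra_leftIdeal_eq_top (N : Submodule k (SRA ρ ω t c)) (h1 : 1 ∈ N)
    (hv : ∀ v, ∀ x ∈ N, sraVec ρ ω t c v * x ∈ N)
    (hg : ∀ g, ∀ x ∈ N, sraGrp ρ ω t c g * x ∈ N) : N = ⊤ := by
  rw [eq_top_iff]
  rintro a -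
  suffices H : ∀ x ∈ N, a * x ∈ N by simpa using H 1 h1
  obtain ⟨a, rfl⟩ := RingQuot.mkAlgHom_surjective k (SRARel ρ ω t c) a
  -- Elements of `T(V)` are handled before the group factors.
  have hT : ∀ (q : TensorAlgebra k V), ∀ x ∈ N,
      RingQuot.mkAlgHom k (SRARel ρ ω t c) (inclAlg (tensorAction ρ) q) * x ∈ N := by
    intro q
    induction q using TensorAlgebra.induction with
    | algebraMap r =>
      intro x hx
      rw [AlgHom.commutes, AlgHom.commutes, ← Algebra.smul_def]
      exact N.smul_mem _ hx
    | ι v => exact fun x hx => hv v x hx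
    | mul p q hp hq => intro x hx; rw [map_mul, map_mul, mul_assoc]; exact hp _ (hq _ hx)
    | add p q hp hq =>
      intro x hx
      rw [map_add, map_add, add_mul]
      exact N.add_mem (hp _ hx) (hq _ hx)
  induction a using SkewMonoidAlgebra.induction_on' with
  | single g q =>
    intro x hx
    have e : (SkewMonoidAlgebra.single g q : SkewGroupAlgebra (tensorAction ρ))
        = inclAlg (tensorAction ρ) q * inclGrp (tensorAction ρ) g := by
      change _ = (SkewMonoidAlgebra.single (1 : G) q : SkewGroupAlgebra (tensorAction ρ))
        * SkewMonoidAlgebra.single g (1 : WithAction (tensorAction ρ))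
      rw [SkewMonoidAlgebra.single_mul_single, one_mul, smul_one, mul_one]
    rw [e, map_mul, mul_assoc]
    exact hT _ _ (hg _ _ hx)
  | add w w' hw hw' => intro x hx; rw [map_add, add_mul]; exact N.add_mem (hw x hx) (hw' x hx)

variable {B : Type*} [Ring B] [Algebra k B]

/-- The universal property of the symplectic reflection algebra. -/
def sraLift (f : V →ₗ[k] B) (e : G →* B) (hcomm : ∀ g v, e g * f v = f (ρ g v) * e g)
    (hrel : ∀ x y, f x * f y - f y * f x = algebraMap k B (t * ω x y)
      - ∑ s ∈ symplecticReflections ρ, (c s * reflForm ρ ω s x y) • e s) :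
    SRA ρ ω t c →ₐ[k] B :=
  RingQuot.liftAlgHom k ⟨skewLift (tensorAction ρ) (TensorAlgebra.lift k f) e (by
      intro g q
      induction q using TensorAlgebra.induction with
      | algebraMap r => simp only [AlgHom.commutes, Algebra.commutes]
      | ι v =>
        rw [TensorAlgebra.lift_ι_apply, hcomm]
        simp [tensorAction]
      | mul p q hp hq => rw [map_mul, map_mul, map_mul, ← mul_assoc, hp, mul_assoc, hq, mul_assoc]
      | add p q hp hq => rw [map_add, map_add, map_add, mul_add, hp, hq, add_mul]), by
    rintro _ _ ⟨x, y⟩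
    rw [skewLift_inclAlg, map_sub, map_sub, AlgHom.commutes, map_sum]
    simp only [map_mul, TensorAlgebra.lift_ι_apply, map_smul, skewLift_inclGrp]
    rw [hrel, map_mul]⟩

theorem sraLift_vec (f : V →ₗ[k] B) (e : G →* B) (hcomm : ∀ g v, e g * f v = f (ρ g v) * e g)
    (hrel : ∀ x y, f x * f y - f y * f x = algebraMap k B (t * ω x y)
      - ∑ s ∈ symplecticReflections ρ, (c s * reflForm ρ ω s x y) • e s) (v : V) :
    sraLift ρ ω t c f e hcomm hrel (sraVec ρ ω t c v) = f v := by
  refine (RingQuot.liftAlgHom_mkAlgHom_apply _ _ _ _).trans ?_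
  rw [AlgHom.coe_toRingHom, skewLift_inclAlg, TensorAlgebra.lift_ι_apply]

theorem sraLift_grp (f : V →ₗ[k] B) (e : G →* B) (hcomm : ∀ g v, e g * f v = f (ρ g v) * e g)
    (hrel : ∀ x y, f x * f y - f y * f x = algebraMap k B (t * ω x y)
      - ∑ s ∈ symplecticReflections ρ, (c s * reflForm ρ ω s x y) • e s) (g : G) :
    sraLift ρ ω t c f e hcomm hrel (sraGrp ρ ω t c g) = e g := by
  refine (RingQuot.liftAlgHom_mkAlgHom_apply _ _ _ _).trans ?_
  exact skewLift_inclGrp _ _ _ _ _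

end SRA

/-! ### Normally ordered monomials span the Cherednik algebra -/

section RCA

variable {k h G : Type*} [Field k] [AddCommGroup h] [Module k h] [FiniteDimensional k h]
  [Group G] [Fintype G] {n : ℕ} {ρ : Representation k G h} {α : G → Module.Dual k h}
  (hα : ∀ s ∈ pseudoReflections ρ,
    LinearMap.ker (α s) = LinearMap.ker (LinearMap.id - ρ s))
  (ho : ∀ s : G, (orderOf s : k) ≠ 0) (c : G → k)

theorem polyH_ι (f : Module.Dual k h) : polyH ρ c (SymmetricAlgebra.ι k _ f) = rcaY ρ c f :=
  symLift_ι _ _ _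

theorem sraVec_eq (v : h × Module.Dual k h) :
    sraVec (doubleRep ρ) (canonicalForm k h) 1 c v = rcaX ρ c v.1 + rcaY ρ c v.2 := by
  simp [rcaX, rcaY, ← map_add]

theorem rcaGrp_mul_rcaX (g : G) (u : h) :
    rcaGrp ρ c g * rcaX ρ c u = rcaX ρ c (ρ g u) * rcaGrp ρ c g := by
  refine (sraGrp_mul_sraVec _ _ _ _ _ _).trans ?_
  simp [rcaX, rcaGrp]

theorem rcaGrp_mul_rcaY (g : G) (f : Module.Dual k h) :
    rcaGrp ρ c g * rcaY ρ c f = rcaY ρ c (ρ.dual g f) * rcaGrp ρ c g := by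
  refine (sraGrp_mul_sraVec _ _ _ _ _ _).trans ?_
  simp [rcaY, rcaGrp]

theorem rcaGrp_mul_polyH (g : G) (p : SymmetricAlgebra k (Module.Dual k h)) :
    rcaGrp ρ c g * polyH ρ c p = polyH ρ c (symAct ρ g p) * rcaGrp ρ c g := by
  induction p using SymmetricAlgebra.induction with
  | algebraMap r => simp only [AlgHom.commutes, Algebra.commutes]
  | ι f => rw [symAct_ι, polyH_ι, polyH_ι, rcaGrp_mul_rcaY]
  | mul p q hp hq => rw [map_mul, map_mul, map_mul, ← mul_assoc, hp, mul_assoc, hq, mul_assoc]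
  | add p q hp hq => rw [map_add, map_add, map_add, mul_add, hp, hq, add_mul]

include hα ho

theorem rcaX_comm (u v : h) : rcaX ρ c u * rcaX ρ c v = rcaX ρ c v * rcaX ρ c u := by
  rw [← sub_eq_zero]
  refine (sraVec_comm _ _ _ _ _ _).trans ?_
  rw [Finset.sum_eq_zero]
  · simp [canonicalForm_apply]
  · intro s hs
    rw [symplecticReflections_doubleRep] at hs
    rw [reflForm_doubleRep hα hs (ho s)]
    simp

theorem rcaX_mul_rcaY (u : h) (f : Module.Dual k h) :
    rcaX ρ c u * rcaY ρ c f - rcaY ρ c f * rcaX ρ c u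
      = algebraMap k _ (f u) - ∑ s ∈ pseudoReflections ρ,
        (c s * (α s u * f (coroot ρ α s) / α s (coroot ρ α s))) • rcaGrp ρ c s := by
  refine (sraVec_comm _ _ _ _ _ _).trans ?_
  rw [symplecticReflections_doubleRep]
  congr 1
  · simp [canonicalForm_apply]
  · refine Finset.sum_congr rfl fun s hs => ?_
    rw [reflForm_doubleRep hα hs (ho s)]
    simp [rcaGrp]

/-- The map `S(h) → H`. -/
def constH : SymmetricAlgebra k h →ₐ[k] RCA ρ c := symLift (rcaX ρ c) (rcaX_comm hα ho c)

theorem constH_ι (u : h) : constH hα ho c (SymmetricAlgebra.ι k _ u) = rcaX ρ c u :=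
  symLift_ι _ _ _

theorem rcaGrp_mul_constH (g : G) (q : SymmetricAlgebra k h) :
    ∃ q' : SymmetricAlgebra k h,
      rcaGrp ρ c g * constH hα ho c q = constH hα ho c q' * rcaGrp ρ c g := by
  induction q using SymmetricAlgebra.induction with
  | algebraMap r => exact ⟨algebraMap k _ r, by simp only [AlgHom.commutes, Algebra.commutes]⟩
  | ι u => exact ⟨SymmetricAlgebra.ι k _ (ρ g u), by rw [constH_ι, constH_ι, rcaGrp_mul_rcaX]⟩
  | mul p q hp hq =>
    obtain ⟨p', hp⟩ := hp
    obtain ⟨q', hq⟩ := hq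
    exact ⟨p' * q', by rw [map_mul, map_mul, ← mul_assoc, hp, mul_assoc, hq, mul_assoc]⟩
  | add p q hp hq =>
    obtain ⟨p', hp⟩ := hp
    obtain ⟨q', hq⟩ := hq
    exact ⟨p' + q', by rw [map_add, map_add, mul_add, hp, hq, add_mul]⟩

/-- The correction terms lie in `k[h] G` and contain no further vector of `h`; this is what allows
reordering of products to terminate. -/
theorem rcaX_mul_polyH (u : h) (p : SymmetricAlgebra k (Module.Dual k h)) :
    ∃ p' : G → SymmetricAlgebra k (Module.Dual k h),
      rcaX ρ c u * polyH ρ c p = polyH ρ c p * rcaX ρ c u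
        + ∑ g, polyH ρ c (p' g) * rcaGrp ρ c g := by
  classical
  induction p using SymmetricAlgebra.induction with
  | algebraMap r => exact ⟨0, by simp [Algebra.commutes]⟩
  | ι f =>
    refine ⟨fun g => algebraMap k _ ((if g = 1 then f u else 0) - if g ∈ pseudoReflections ρ then
      (c g * (α g u * f (coroot ρ α g) / α g (coroot ρ α g))) else 0), ?_⟩
    rw [polyH_ι, ← sub_eq_iff_eq_add', rcaX_mul_rcaY hα ho]
    simp only [AlgHom.commutes, map_sub, sub_mul, Finset.sum_sub_distrib]
    congr 1
    · rw [Finset.sum_eq_single 1 (by intro g _ hg; rw [if_neg hg]; simp) (by simp), if_pos rfl,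
        map_one, mul_one]
    · rw [← Finset.sum_subset (Finset.subset_univ (pseudoReflections ρ))]
      · refine Finset.sum_congr rfl fun s hs => ?_
        rw [if_pos hs, Algebra.smul_def]
      · intro g _ hg
        rw [if_neg hg]; simp
  | mul p q hp hq =>
    obtain ⟨p', hp⟩ := hp
    obtain ⟨q', hq⟩ := hq
    -- A twisted Leibniz rule: the group elements produced by crossing `p` act on `q` when they are
    -- moved past it.
    refine ⟨fun g => p' g * symAct ρ g q + p * q' g, ?_⟩
    rw [map_mul, ← mul_assoc, hp, add_mul, mul_assoc, hq, mul_add, ← mul_assoc, add_assoc]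
    congr 1
    rw [Finset.sum_mul, Finset.mul_sum, ← Finset.sum_add_distrib]
    refine Finset.sum_congr rfl fun g _ => ?_
    rw [map_add, map_mul, map_mul, mul_assoc _ (rcaGrp ρ c g), rcaGrp_mul_polyH, add_comm, add_mul]
    simp only [mul_assoc]
  | add p q hp hq =>
    obtain ⟨p', hp⟩ := hp
    obtain ⟨q', hq⟩ := hq
    refine ⟨fun g => p' g + q' g, ?_⟩
    simp only [map_add, mul_add, add_mul, hp, hq, Finset.sum_add_distrib]
    abel

/-- The normally ordered monomials `x^β g` of the Cherednik algebra. -/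
def monH (b : Module.Basis (Fin n) k h) (x : (Fin n →₀ ℕ) × G) : RCA ρ c :=
  constH hα ho c (symMonomial b x.1) * rcaGrp ρ c x.2

/-- The normal ordering map `∑ p_{β,g} ξ^β g ↦ ∑ p_{β,g} x^β g`. -/
abbrev rcaOrder (b : Module.Basis (Fin n) k h) :
    ((Fin n →₀ ℕ) × G →₀ SymmetricAlgebra k (Module.Dual k h)) →ₗ[k] RCA ρ c :=
  normalOrder (polyH ρ c) (monH hα ho c b)

theorem polyH_mul_mem_range_rcaOrder (b : Module.Basis (Fin n) k h)
    (p : SymmetricAlgebra k (Module.Dual k h)) {x : RCA ρ c}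
    (hx : x ∈ LinearMap.range (rcaOrder hα ho c b)) :
    polyH ρ c p * x ∈ LinearMap.range (rcaOrder hα ho c b) := by
  obtain ⟨z, rfl⟩ := hx
  exact ⟨p • z, normalOrder_smul _ _ _ _⟩

theorem constH_mul_rcaGrp_mem_range_rcaOrder (b : Module.Basis (Fin n) k h)
    (q : SymmetricAlgebra k h) (g : G) :
    constH hα ho c q * rcaGrp ρ c g ∈ LinearMap.range (rcaOrder hα ho c b) := by
  have hq : q ∈ Submodule.span k (Set.range (symMonomial b)) := by rw [span_symMonomial]; trivial
  induction hq using Submodule.span_induction with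
  | mem x hx =>
    obtain ⟨β, rfl⟩ := hx
    exact ⟨Finsupp.single (β, g) 1, by simp [normalOrder_single, monH]⟩
  | zero => simp
  | add x y _ _ hx hy => rw [map_add, add_mul]; exact Submodule.add_mem _ hx hy
  | smul r x _ hx => rw [map_smul, smul_mul_assoc]; exact Submodule.smul_mem _ _ hx

/-- The spanning half of the Poincaré–Birkhoff–Witt theorem; independence is not needed beforehand,
as it results from the Dunkl homomorphism. -/
theorem rcaOrder_surjective (b : Module.Basis (Fin n) k h) :
    Function.Surjective (rcaOrder hα ho c b) := by
  rw [← LinearMap.range_eq_top]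
  have hgrp : ∀ (g : G) (q : SymmetricAlgebra k h) (g' : G),
      rcaGrp ρ c g * (constH hα ho c q * rcaGrp ρ c g')
        ∈ LinearMap.range (rcaOrder hα ho c b) := by
    intro g q g'
    obtain ⟨q', hq⟩ := rcaGrp_mul_constH hα ho c g q
    rw [← mul_assoc, hq, mul_assoc, ← map_mul]
    exact constH_mul_rcaGrp_mem_range_rcaOrder hα ho c b _ _
  refine sra_leftIdeal_eq_top _ _ _ _ _ ?_ ?_ ?_
  · have := constH_mul_rcaGrp_mem_range_rcaOrder hα ho c b 1 1
    rwa [map_one, map_one, one_mul] at this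
  · rintro v x hx
    rw [sraVec_eq, add_mul, ← polyH_ι]
    refine Submodule.add_mem _ ?_ (polyH_mul_mem_range_rcaOrder hα ho c b _ hx)
    obtain ⟨z, rfl⟩ := hx
    induction z using Finsupp.induction_linear with
    | zero => simp
    | add z z' hz hz' => rw [map_add, mul_add]; exact Submodule.add_mem _ hz hz'
    | single y p =>
      obtain ⟨p', hp⟩ := rcaX_mul_polyH hα ho c v.1 p
      rw [normalOrder_single, ← mul_assoc, hp, add_mul, mul_assoc, Finset.sum_mul]
      refine Submodule.add_mem _ (polyH_mul_mem_range_rcaOrder hα ho c b _ ?_)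
        (Submodule.sum_mem _ fun g _ => ?_)
      · rw [monH, ← mul_assoc, ← constH_ι hα ho, ← map_mul]
        exact constH_mul_rcaGrp_mem_range_rcaOrder hα ho c b _ _
      · rw [mul_assoc]
        exact polyH_mul_mem_range_rcaOrder hα ho c b _ (hgrp _ _ _)
  · rintro g _ ⟨z, rfl⟩
    change rcaGrp ρ c g * _ ∈ _
    induction z using Finsupp.induction_linear with
    | zero => simp
    | add z z' hz hz' => rw [map_add, mul_add]; exact Submodule.add_mem _ hz hz'
    | single y p =>
      rw [normalOrder_single, ← mul_assoc, rcaGrp_mul_polyH, mul_assoc]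
      exact polyH_mul_mem_range_rcaOrder hα ho c b _ (hgrp _ _ _)

end RCA

/-! ### The Dunkl homomorphism, its leading terms and its image after localisation -/

section DunklEmbedding

variable {k h G : Type*} [Field k] [AddCommGroup h] [Module k h] [FiniteDimensional k h]
  [Group G] [Fintype G] {n : ℕ} {ρ : Representation k G h} {α : G → Module.Dual k h}
  (hα : ∀ s ∈ pseudoReflections ρ,
    LinearMap.ker (α s) = LinearMap.ker (LinearMap.id - ρ s))
  (ho : ∀ s : G, (orderOf s : k) ≠ 0) (c : G → k)
  (hc : ∀ s ∈ pseudoReflections ρ, ∀ g : G, c (g * s * g⁻¹) = c s)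
  (hρ : Function.Injective ρ)

theorem coordD_mul_coordD (f f' : Module.Dual k h) :
    diffW ρ α hα (coordD f) * diffW ρ α hα (coordD f')
      = diffW ρ α hα (coordD f') * diffW ρ α hα (coordD f) := by
  rw [← map_mul, coordD_comm, map_mul]

/-- The images of the generators of the Cherednik algebra in `D(h^reg) ∗ G`. -/
def dunklVec : h × Module.Dual k h →ₗ[k] RegSkew ρ α hα :=
  (dunkl ρ α hα c).coprod ((diffW ρ α hα).toLinearMap ∘ₗ coordD)

theorem dunklVec_apply (v : h × Module.Dual k h) :
    dunklVec hα c v = dunkl ρ α hα c v.1 + diffW ρ α hα (coordD v.2) := rfl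

/-- The Dunkl homomorphism `H → D(h^reg) ∗ G`. -/
def dunklHom : RCA ρ c →ₐ[k] RegSkew ρ α hα :=
  sraLift (doubleRep ρ) (canonicalForm k h) 1 c (dunklVec hα c) (grpW ρ α hα)
    (by
      intro g v
      rw [dunklVec_apply, mul_add, grpW_mul_dunkl hα c hc ho, grpW_mul_diffW, diffAction_coordD,
        ← add_mul]
      rfl)
    (by
      intro x y
      rw [symplecticReflections_doubleRep, dunklVec_apply, dunklVec_apply]
      have h1 := dunkl_mul_coordD hα c x.1 y.2
      have h2 := dunkl_mul_coordD hα c y.1 x.2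
      have h3 := dunkl_comm hα hρ c hc ho x.1 y.1
      have h4 := coordD_mul_coordD hα x.2 y.2
      -- Splitting `ω_s(x,y)` into its two antisymmetric halves matches the brackets `[D_{x.1},
      -- y.2]` and `[D_{y.1}, x.2]`.
      have h5 : ∑ s ∈ pseudoReflections ρ,
          (c s * reflForm (doubleRep ρ) (canonicalForm k h) s x y) • grpW ρ α hα s
          = ∑ s ∈ pseudoReflections ρ,
            (c s * (α s x.1 * y.2 (coroot ρ α s) / α s (coroot ρ α s))) • grpW ρ α hα s
          - ∑ s ∈ pseudoReflections ρ,
            (c s * (α s y.1 * x.2 (coroot ρ α s) / α s (coroot ρ α s))) • grpW ρ α hα s := by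
        rw [← Finset.sum_sub_distrib]
        refine Finset.sum_congr rfl fun s hs => ?_
        rw [reflForm_doubleRep hα hs (ho s), ← sub_smul]
        congr 1
        ring
      rw [h5, canonicalForm_apply, one_mul, map_sub,
        sub_sub_sub_comm, ← h1, ← h2, mul_add, mul_add, add_mul, add_mul, add_mul, add_mul, h3, h4]
      abel)

theorem dunklHom_grp (g : G) :
    dunklHom hα ho c hc hρ (rcaGrp ρ c g) = grpW ρ α hα g := sraLift_grp _ _ _ _ _ _ _ _ _

theorem dunklHom_rcaX (u : h) :
    dunklHom hα ho c hc hρ (rcaX ρ c u) = dunkl ρ α hα c u := by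
  refine (sraLift_vec _ _ _ _ _ _ _ _ _).trans ?_
  simp [dunklVec]

theorem dunklHom_rcaY (f : Module.Dual k h) :
    dunklHom hα ho c hc hρ (rcaY ρ c f) = diffW ρ α hα (coordD f) := by
  refine (sraLift_vec _ _ _ _ _ _ _ _ _).trans ?_
  simp [dunklVec]

theorem dunklHom_polyH (p : SymmetricAlgebra k (Module.Dual k h)) :
    dunklHom hα ho c hc hρ (polyH ρ c p) = polyW ρ α hα p := by
  have : (dunklHom hα ho c hc hρ).comp (polyH ρ c) = polyW ρ α hα := by
    refine sym_hom_ext fun f => ?_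
    rw [AlgHom.comp_apply, polyH_ι, dunklHom_rcaY, polyW_apply, polyD_ι]
  exact DFunLike.congr_fun this p

theorem mul_dunklTail_mem_orderLT {b : Module.Basis (Fin n) k h} {m : ℕ} (u : h)
    {w : RegSkew ρ α hα} (hw : w ∈ orderLT ρ α hα b m) :
    w * dunklTail ρ α hα c u ∈ orderLT ρ α hα b m := by
  rw [dunklTail_apply, Finset.mul_sum]
  refine Submodule.sum_mem _ fun s hs => ?_
  rw [mul_smul_comm, rootInvRefl, ← mul_assoc]
  exact Submodule.smul_mem _ _ (mul_grpW_mem_orderLT ρ α hα _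
    (mul_regFun_mem_orderLT ρ α hα (rootInv_mem_regFun ρ α hs) hw))

/-- The leading term of the image of `x^β` is `∂^β`, because the tails `T_u` have order zero. For `β
= 0` the error must vanish, and it does: both sides are `1`. -/
theorem dunklHom_constH_sub_mem (b : Module.Basis (Fin n) k h) (β : Fin n →₀ ℕ) :
    dunklHom hα ho c hc hρ (constH hα ho c (symMonomial b β))
      - diffW ρ α hα (constD (symMonomial b β)) ∈ orderLT ρ α hα b β.degree := by
  induction β using exponent_induction with
  | h0 => simp [symMonomial_zero]
  | hadd β i ih =>
    -- Expanding `Θ(x^β)(∂_i + T_i) - ∂^β ∂_i`: right multiplication of the old error by `∂_i`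
    -- raises its order by one, and the terms with `T_i` do not raise the order.
    have h1 : dunklHom hα ho c hc hρ (constH hα ho c (symMonomial b (β + Finsupp.single i 1)))
        - diffW ρ α hα (constD (symMonomial b (β + Finsupp.single i 1)))
        = (dunklHom hα ho c hc hρ (constH hα ho c (symMonomial b β))
            - diffW ρ α hα (constD (symMonomial b β))) * diffW ρ α hα (partialD (b i))
          + (dunklHom hα ho c hc hρ (constH hα ho c (symMonomial b β))
            - diffW ρ α hα (constD (symMonomial b β))) * dunklTail ρ α hα c (b i)
          + diffW ρ α hα (constD (symMonomial b β)) * dunklTail ρ α hα c (b i) := by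
      rw [← monW_mul_partial, symMonomial_add_single, map_mul, map_mul, constH_ι, dunklHom_rcaX,
        dunkl_apply]
      noncomm_ring
    have h2 : (β + Finsupp.single i 1).degree = β.degree + 1 := by simp
    have h3 : diffW ρ α hα (constD (symMonomial b β)) ∈ orderLT ρ α hα b (β.degree + 1) := by
      have := monW_mem_orderLT ρ α hα b (x := (β, 1)) (Nat.lt_succ_self _)
      rwa [monW, map_one, mul_one] at this
    rw [h1, h2]
    refine Submodule.add_mem _ (Submodule.add_mem _ (mul_partial_mem_orderLT ρ α hα _ ih) ?_)
      (mul_dunklTail_mem_orderLT hα c _ h3)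
    exact orderLT_mono ρ α hα b (Nat.le_succ _) (mul_dunklTail_mem_orderLT hα c _ ih)

theorem dunklHom_monH_sub_mem (b : Module.Basis (Fin n) k h) (x : (Fin n →₀ ℕ) × G) :
    dunklHom hα ho c hc hρ (monH hα ho c b x) - monW ρ α hα b x
      ∈ orderLT ρ α hα b x.1.degree := by
  rw [monH, monW, map_mul, dunklHom_grp, ← sub_mul]
  exact mul_grpW_mem_orderLT ρ α hα _ (dunklHom_constH_sub_mem hα ho c hc hρ b x.1)

theorem dunklHom_rcaOrder_sub_mem (b : Module.Basis (Fin n) k h) {m : ℕ}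
    {z : (Fin n →₀ ℕ) × G →₀ SymmetricAlgebra k (Module.Dual k h)}
    (hz : ∀ x ∈ z.support, x.1.degree ≤ m) :
    dunklHom hα ho c hc hρ (rcaOrder hα ho c b z) - skewOrder ρ α hα b z
      ∈ orderLT ρ α hα b m := by
  rw [← Finsupp.sum_single z, Finsupp.sum, map_sum, map_sum, map_sum, ← Finset.sum_sub_distrib]
  refine Submodule.sum_mem _ fun x hx => ?_
  rw [normalOrder_single, normalOrder_single, map_mul, dunklHom_polyH, ← mul_sub]
  exact (orderLT_isRegStable ρ α hα b m).poly_mul_mem _ _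
    (orderLT_mono ρ α hα b (hz x hx) (dunklHom_monH_sub_mem hα ho c hc hρ b x))

/-- If `z` has degree at most `m` and its image is zero, its normal-ordered symbol has order less
than `m`. By independence of the `∂^β g`, the coefficients of degree `m` are killed by a power of
`δ`, hence vanish; the degree bound descends to zero. -/
theorem dunklHom_injective : Function.Injective (dunklHom hα ho c hc hρ) := by
  let b := Module.finBasis k h
  have key : ∀ (m : ℕ) (z : (Fin _ →₀ ℕ) × G →₀ SymmetricAlgebra k (Module.Dual k h)),
      (∀ x ∈ z.support, x.1.degree < m) →
      dunklHom hα ho c hc hρ (rcaOrder hα ho c b z) = 0 → z = 0 := by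
    intro m
    induction m with
    | zero =>
      intro z hz _
      rw [← Finsupp.support_eq_empty, Finset.eq_empty_iff_forall_notMem]
      exact fun x hx => Nat.not_lt_zero _ (hz x hx)
    | succ m ih =>
      intro z hz h0
      refine ih z ?_ h0
      have h1 := dunklHom_rcaOrder_sub_mem hα ho c hc hρ b fun x hx => Nat.lt_succ_iff.1 (hz x hx)
      rw [h0, zero_sub, Submodule.neg_mem_iff] at h1
      obtain ⟨N, z', hz', he⟩ := h1
      rw [← map_pow, ← normalOrder_smul] at he
      have h2 := skewOrder_injective ρ α hα b he
      intro x hx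
      refine hz' (Finsupp.mem_support_iff.2 ?_)
      rw [← h2, Finsupp.smul_apply, smul_eq_mul]
      exact mul_ne_zero (pow_ne_zero _ (delta_ne_zero ρ α hα)) (Finsupp.mem_support_iff.1 hx)
  rw [injective_iff_map_eq_zero]
  intro a ha
  obtain ⟨z, rfl⟩ := rcaOrder_surjective hα ho c b a
  -- The bound in `key` is strict, hence the `+ 1` over the largest degree in the support.
  rw [key (z.support.sup (fun x => x.1.degree) + 1) z
    (fun x hx => Nat.lt_succ_iff.2 (Finset.le_sup (f := fun x => x.1.degree) hx)) ha, map_zero]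

theorem exists_delta_pow_mul_eq_dunklHom (w : RegSkew ρ α hα) :
    ∃ (j : ℕ) (a : RCA ρ c), polyW ρ α hα (delta ρ α) ^ j * w = dunklHom hα ho c hc hρ a := by
  let b := Module.finBasis k h
  -- The elements reaching the image of `H` after multiplication by a power of `δ`; this subspace is
  -- stable under `k[h]` and `δ⁻¹`, so it suffices that it contain the monomials.
  let U : Submodule k (RegSkew ρ α hα) :=
    { carrier := {w | ∃ (j : ℕ) (a : RCA ρ c),
        polyW ρ α hα (delta ρ α) ^ j * w = dunklHom hα ho c hc hρ a}
      zero_mem' := ⟨0, 0, by simp⟩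
      add_mem' := by
        rintro w w' ⟨j, a, ha⟩ ⟨j', a', ha'⟩
        refine ⟨j + j', polyH ρ c (delta ρ α ^ j') * a + polyH ρ c (delta ρ α ^ j) * a', ?_⟩
        rw [map_add, map_mul, map_mul, dunklHom_polyH, dunklHom_polyH, ← ha, ← ha', mul_add,
          map_pow, map_pow, ← mul_assoc, ← mul_assoc, ← pow_add, ← pow_add, add_comm j']
      smul_mem' := by
        rintro r w ⟨j, a, ha⟩
        exact ⟨j, r • a, by rw [mul_smul_comm, ha, map_smul]⟩ }
  have hU : IsRegStable ρ α hα U :=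
    { poly_mul_mem := by
        rintro p w ⟨j, a, ha⟩
        refine ⟨j, polyH ρ c p * a, ?_⟩
        rw [map_mul, dunklHom_polyH, ← ha, ← mul_assoc, ← mul_assoc, ← map_pow, ← map_mul,
          mul_comm, map_mul]
      of_delta_mul_mem := by
        rintro w ⟨j, a, ha⟩
        exact ⟨j + 1, a, by rw [pow_succ, mul_assoc, ha]⟩ }
  have hmon : ∀ m, orderLT ρ α hα b m ≤ U := by
    intro m
    induction m with
    | zero => rw [orderLT_zero]; exact bot_le
    | succ m ih =>
      refine orderLT_le ρ α hα hU fun x hx => ?_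
      -- The error `Θ(x^β g) - ∂^β g` has smaller order and lies in `U` by induction, while `Θ(x^β
      -- g)` lies in `U` trivially; the difference is `∂^β g`.
      have h1 := ih (orderLT_mono ρ α hα b (Nat.lt_succ_iff.1 hx)
        (dunklHom_monH_sub_mem hα ho c hc hρ b x))
      have h2 : dunklHom hα ho c hc hρ (monH hα ho c b x) ∈ U := ⟨0, _, by rw [pow_zero, one_mul]⟩
      have h3 := U.sub_mem h2 h1
      rwa [sub_sub_cancel] at h3
  have htop := hU.eq_top b fun x => hmon _ (monW_mem_orderLT ρ α hα b (Nat.lt_succ_self _))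
  have hw : w ∈ U := by rw [htop]; trivial
  exact hw

end DunklEmbedding

end

end Cherednik

theorem theorem4p3 {k h G : Type*} [Field k] [IsAlgClosed k] (p : ℕ) [Fact p.Prime] [CharP k p]
    [AddCommGroup h] [Module k h] [FiniteDimensional k h] [Group G] [Fintype G]
    (ρ : Representation k G h) (hρ : Function.Injective ρ)
    (hunit : IsUnit ((2 * Fintype.card G : ℕ) : k))
    (hgen : Subgroup.closure (Cherednik.pseudoReflections ρ : Set G) = ⊤)
    (c : G → k) (hc : ∀ s ∈ Cherednik.pseudoReflections ρ, ∀ g : G, c (g * s * g⁻¹) = c s)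
    (α : G → Module.Dual k h)
    (hα : ∀ s ∈ Cherednik.pseudoReflections ρ,
      LinearMap.ker (α s) = LinearMap.ker (LinearMap.id - ρ s))
    {n : ℕ} (b : Module.Basis (Fin n) k h) :
    ∃ τ : Fin n → Cherednik.SkewGroupAlgebra (Cherednik.regAction ρ α hα),
      (∀ i, τ i ∈ Cherednik.rootSpan ρ α hα) ∧
      ∃ Θ : Cherednik.RCA ρ c →ₐ[k] Cherednik.SkewGroupAlgebra (Cherednik.regAction ρ α hα),
        (∀ g : G, Θ (Cherednik.rcaGrp ρ c g) = Cherednik.inclGrp (Cherednik.regAction ρ α hα) g) ∧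
        (∀ i, Θ (Cherednik.rcaY ρ c (b.coord i)) =
          Cherednik.inclAlg (Cherednik.regAction ρ α hα)
            (Cherednik.toReg ρ α (Cherednik.coordD (b.coord i)))) ∧
        (∀ i, Θ (Cherednik.rcaX ρ c (b i)) =
          Cherednik.inclAlg (Cherednik.regAction ρ α hα)
            (Cherednik.toReg ρ α (Cherednik.partialD (b i))) + τ i) ∧
        Function.Injective Θ ∧
        ∃ (_ : OreLocalization.OreSet
              (Submonoid.powers (Cherednik.polyH ρ c (Cherednik.delta ρ α))))
          (Φ : OreLocalization (Submonoid.powers (Cherednik.polyH ρ c (Cherednik.delta ρ α)))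
              (Cherednik.RCA ρ c) ≃ₐ[k] Cherednik.SkewGroupAlgebra (Cherednik.regAction ρ α hα)),
          ∀ a : Cherednik.RCA ρ c, Φ (OreLocalization.numeratorHom a) = Θ a := by
  have hcard : ((Fintype.card G : ℕ) : k) ≠ 0 := by
    rw [Nat.cast_mul] at hunit
    exact right_ne_zero_of_mul hunit.ne_zero
  -- Orders of elements divide the order of the group, which is invertible in `k`.
  have ho : ∀ s : G, (orderOf s : k) ≠ 0 := by
    intro s h0
    obtain ⟨d, hd⟩ := orderOf_dvd_card (x := s)
    exact hcard (by rw [hd, Nat.cast_mul, h0, zero_mul])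
  refine ⟨fun i => Cherednik.dunklTail ρ α hα c (b i),
    fun i => Cherednik.dunklTail_mem_rootSpan ρ α hα c (b i),
    Cherednik.dunklHom hα ho c hc hρ,
    fun g => Cherednik.dunklHom_grp hα ho c hc hρ g,
    fun i => Cherednik.dunklHom_rcaY hα ho c hc hρ (b.coord i),
    fun i => Cherednik.dunklHom_rcaX hα ho c hc hρ (b i),
    Cherednik.dunklHom_injective hα ho c hc hρ, ?_⟩
  refine Cherednik.exists_oreLocalization_equiv (Cherednik.dunklHom hα ho c hc hρ)
    (Cherednik.dunklHom_injective hα ho c hc hρ) _ ?_ fun w => ?_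
  · rw [Cherednik.dunklHom_polyH]
    exact Cherednik.isUnit_polyW_delta
  · rw [Cherednik.dunklHom_polyH]
    exact Cherednik.exists_delta_pow_mul_eq_dunklHom hα ho c hc hρ w
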